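/- Let $q$ be a prime power, let $n\ge 2$ and $r$ be integers with $n/2\le r\le n-1$ and $\gcd(n,r)=1$, and assume that $q$ is odd if $n=2$. Put $T_n(z)=z+z^q+\cdots+z^{q^{n-1}}$, let $f_r(x)$ be the remainder of $T_n(x^{1+q^r})$ modulo $x^{q^n}-x$, and let $\mathcal X_{n,r}$ be the nonsingular projective model of the plane curve $T_n(y)=f_r(x)$ over $\mathbb F_{q^n}$. For a rational point $P$ of a curve, let $H(P)$ be the set of all $m\in\mathbb N_0$ such that some nonzero rational function has pole divisor $mP$; $H(P)$ is called symmetric if its largest gap (element of $\mathbb N_0\setminus H(P)$) equals $2g-1$, where $g$ is the number of its gaps. The plane curve $T_n(y)=f_r(x)$ is geometrically irreducible, exactly one point $P_\infty$ of $\mathcal X_{n,r}$ lies over the point $(0:1:0)$ of its projective closure, and $P_\infty$ is $\mathbb F_{q^n}$-rational. Moreover, $\mathcal X_{n,r}$ is a Castle curve (with respect to $P_\infty$): the Weierstrass semigroup $H(P_\infty)=\{0=m_1<m_2<\cdots\}$ is symmetric, and $$\#\mathcal X_{n,r}(\mathbb F_{q^n})=m_2\,q^n+1 .$$ Here $m_2=q^{n-1}$,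 so that $\#\mathcal X_{n,r}(\mathbb F_{q^n})=q^{2n-1}+1$. -/

import Mathlib

open Polynomial

noncomputable section

namespace CastleCurve

/-! ### Points of the nonsingular projective model of a function field -/

/-- A place of a function field `F` over `K`: a discrete valuation ring of `F` that contains `K`
and has fraction field `F`. The places are the closed points of the nonsingular projective curve
over `K` with function field `F`. -/
structure Place (K F : Type*) [Field K] [Field F] [Algebra K F] where
  /-- the local ring at the point -/
  ring : ValuationSubring F
  isDVR : IsDiscreteValuationRing ring
  algebraMap_mem : ∀ c : K, algebraMap K F c ∈ ring

namespace Place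

variable {K F : Type*} [Field K] [Field F] [Algebra K F]

/-- The normalized discrete valuation at `P`, written multiplicatively: its value at `f ≠ 0` is
`exp (-v_P(f))`. -/
def valuation (P : Place K F) : Valuation F (WithZero (Multiplicative ℤ)) :=
  haveI := P.isDVR
  (IsDiscreteValuationRing.maximalIdeal P.ring).valuation F

/-- The integer `v_P(f)` (with the junk value `0` at `f = 0`). -/
def ord (P : Place K F) (f : F) : ℤ := -WithZero.log (P.valuation f)

/-- The coefficient of `P` in the pole divisor of `f`, that is `max (-v_P(f)) 0`. -/
def poleOrder (P : Place K F) (f : F) : ℕ := (-P.ord f).toNat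

/-- The inclusion of the constants into the local ring at `P`. -/
def constants (P : Place K F) : K →+* P.ring :=
  (algebraMap K F).codRestrict P.ring.toSubring P.algebraMap_mem

/-- `P` is a `K`-rational point: its residue field is `K`. -/
def IsRational (P : Place K F) : Prop :=
  Function.Surjective ((IsLocalRing.residue P.ring).comp P.constants)

/-- The Weierstrass semigroup `H(P)`: the `m` for which some `f ≠ 0` has pole divisor `m P`. -/
def weierstrassSemigroup (P : Place K F) : Set ℕ :=
  {m | ∃ f : F, f ≠ 0 ∧ P.poleOrder f = m ∧ ∀ Q : Place K F, Q ≠ P → Q.poleOrder f = 0}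

end Place

/-- A semigroup `S ⊆ ℕ` is symmetric if its largest gap is `2 g - 1`, where `g` is the number of
its gaps. -/
def IsSymmetric (S : Set ℕ) : Prop :=
  ∃ l : ℕ, IsGreatest Sᶜ l ∧ l + 1 = 2 * Sᶜ.ncard

/-- The curve with function field `F` over `K` is a Castle curve with respect to the rational point
`P`: the semigroup `H(P) = {0 = m₁ < m₂ < ⋯}` is symmetric and the curve has exactly
`m₂ * #K + 1` rational points. -/
def IsCastle {K F : Type*} [Field K] [Field F] [Algebra K F] (P : Place K F) : Prop :=
  P.IsRational ∧ IsSymmetric P.weierstrassSemigroup ∧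
    ∃ m₂ : ℕ, IsLeast {m | m ∈ P.weierstrassSemigroup ∧ m ≠ 0} m₂ ∧
      Nat.card {Q : Place K F // Q.IsRational} = m₂ * Nat.card K + 1

/-! ### The curves `T_n(y) = f_r(x)` -/

section Curve

variable (K : Type*) [Field K] (q n r : ℕ)

/-- `T_n(z) = z + z ^ q + ⋯ + z ^ (q ^ (n - 1))`. -/
def T {A : Type*} [Semiring A] (z : A) : A := ∑ i ∈ Finset.range n, z ^ q ^ i

/-- `f_r(x)`, the remainder of `T_n(x ^ (1 + q ^ r))` modulo `x ^ (q ^ n) - x`. -/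
def fPoly : K[X] := T q n ((X : K[X]) ^ (1 + q ^ r)) %ₘ (X ^ q ^ n - X)

/-- The polynomial `T_n(Y) - f_r(X)`, as an element of `K[X][Y]`. -/
def curvePoly : K[X][X] := T q n (X : K[X][X]) - C (fPoly K q n r)

/-- The coordinate ring `K[X, Y] / (T_n(Y) - f_r(X))` of the affine curve. -/
abbrev CoordinateRing : Type _ := AdjoinRoot (curvePoly K q n r)

/-- The fraction field `K(x, y)` of the coordinate ring. -/
abbrev FunctionField : Type _ := FractionRing (CoordinateRing K q n r)

/-- The coordinate function `x`. -/
def xFun : FunctionField K q n r :=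
  algebraMap (CoordinateRing K q n r) _ (AdjoinRoot.of _ X)

/-- The coordinate function `y`. -/
def yFun : FunctionField K q n r :=
  algebraMap (CoordinateRing K q n r) _ (AdjoinRoot.root _)

/-- The affine curve is geometrically irreducible. -/
def IsGeometricallyIrreducible : Prop :=
  Irreducible ((curvePoly K q n r).map (mapRingHom (algebraMap K (AlgebraicClosure K))))

/-- The place `P` lies over the point `(0 : 1 : 0)` of the projective closure of the plane curve:
the affine coordinates `x / y` and `1 / y` around that point vanish at `P`. -/
def LiesOverInfinity [IsDomain (CoordinateRing K q n r)]
    (P : Place K (FunctionField K q n r)) : Prop :=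
  P.valuation (xFun K q n r / yFun K q n r) < 1 ∧ P.valuation (1 / yFun K q n r) < 1

end Curve

end CastleCurve

end

open Polynomial

/-! ### The additive polynomials `T_n` and the functions `t`, `u`, `w` -/

namespace CastleCurve

section Additive

variable {A : Type*} [CommRing A] {q : ℕ}

/-! Let A = K[x,y]/(T_n(y) − f_r(x)), a free K[x]-module of rank e = q^(n−1). The point at infinity
is read off from an explicit pole-order function on A, and the remaining points from the fact that A
is Dedekind.

Put s = n − r. Reducing modulo x^(q^n) − x gives f_r = T_s(x^(1+q^r)) + T_r(x^(1+q^s)) (`fPoly_eq`).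
Since r and s are coprime, Euclid's algorithm on additive polynomials produces a function t
(`exists_parameter`), and for s < r two further cancellations produce u and w (`exists_generators`).
Each of y, t, u, w has a power equal, up to a sign and terms of smaller pole order, to a power of x
times at most one earlier generator. Giving x the weight e, balancing leading terms determines the
other weights a_i. The exponents p_i of these powers have product e, and the sums Σ c_i a_i with 0 ≤
c_i < p_i are pairwise incongruent modulo e (`residue_injective_general`). So the reduced monomials
form a K-basis of A with distinct weights, and the largest weight occurring in a function defines a
valuation (`RewriteSystem.exists_isWeightValuation`). The case s = r occurs only for n = 2; there
y^q + y = 2x^(q+1), the generator y suffices, and 2 ≠ 0 is needed.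

This valuation vanishes only at 0, so A is a domain. The argument works over any field of
characteristic p, in particular over the algebraic closure, which gives geometric irreducibility. A
place where x has a pole must be the place of the valuation (`IsWeightValuation.eq_place`). The
curve equation has y-derivative 1, so A is integrally closed (`isDedekindDomain_adjoinRoot`); hence
the functions with no pole outside infinity are exactly the elements of A, and the Weierstrass
semigroup is the set of weights. Unique reduced representations provide a reflection exchanging gaps
and non-gaps (`isSymmetric_range_weight`). Finally, on K-points the equation reads T_n(y −
x^(1+q^r)) = 0, and the kernel of the trace T_n has q^(n−1) elements. -/

/-- Raising to the power `q` is additive on `A`. -/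
def PowAdditive (A : Type*) [CommRing A] (q : ℕ) : Prop := ∀ a b : A, (a + b) ^ q = a ^ q + b ^ q

namespace PowAdditive

lemma of_charP (p m : ℕ) [Fact p.Prime] [CharP A p] : PowAdditive A (p ^ m) :=
  fun a b => add_pow_char_pow a b p m

lemma add_pow (h : PowAdditive A q) (i : ℕ) (a b : A) :
    (a + b) ^ q ^ i = a ^ q ^ i + b ^ q ^ i := by
  induction i with
  | zero => simp
  | succ i ih => rw [pow_succ, pow_mul, pow_mul, pow_mul, ih, h]

lemma sub_pow (h : PowAdditive A q) (i : ℕ) (a b : A) :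
    (a - b) ^ q ^ i = a ^ q ^ i - b ^ q ^ i := by
  rw [eq_sub_iff_add_eq, ← h.add_pow, sub_add_cancel]

lemma zero_pow (h : PowAdditive A q) (i : ℕ) : (0 : A) ^ q ^ i = 0 := by
  simpa using h.sub_pow i 0 0

lemma sum_pow (h : PowAdditive A q) (i : ℕ) {ι : Type*} (s : Finset ι) (f : ι → A) :
    (∑ j ∈ s, f j) ^ q ^ i = ∑ j ∈ s, f j ^ q ^ i := by
  classical
  induction s using Finset.induction_on with
  | empty => simpa using h.zero_pow i
  | insert a s ha ih => rw [Finset.sum_insert ha, Finset.sum_insert ha, h.add_pow, ih]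

end PowAdditive

lemma T_zero (z : A) : T q 0 z = 0 := by simp [T]

lemma T_one (z : A) : T q 1 z = z := by simp [T]

lemma T_succ (n : ℕ) (z : A) : T q (n + 1) z = T q n z + z ^ q ^ n := by
  simp [T, Finset.sum_range_succ]

lemma T_sub (h : PowAdditive A q) (n : ℕ) (a b : A) : T q n (a - b) = T q n a - T q n b := by
  simp [T, h.sub_pow]

lemma T_pow (h : PowAdditive A q) (n i : ℕ) (z : A) : T q n (z ^ q ^ i) = T q n z ^ q ^ i := by
  simp only [T, h.sum_pow, ← pow_mul]
  exact Finset.sum_congr rfl fun j _ => by rw [mul_comm]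

lemma T_add_index (h : PowAdditive A q) (a b : ℕ) (z : A) :
    T q (a + b) z = T q a z + T q b z ^ q ^ a := by
  rw [← T_pow h]
  simp only [T, Finset.sum_range_add, ← pow_mul, ← pow_add]

/-- If `a` and `b` are coprime, then `T_a` and `T_b` generate the unit ideal among the additive
polynomials, so a solution of `T_a(z) = T_b(w)` comes from a common parameter `t`. -/
lemma exists_T_eq_and_T_eq (h : PowAdditive A q) : ∀ N a b : ℕ, a + b ≤ N → Nat.Coprime a b →
    ∀ z w : A, T q a z = T q b w → ∃ t, T q b t = z ∧ T q a t = w := by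
  intro N
  induction N with
  | zero =>
    intro a b hab hcop
    obtain ⟨rfl, rfl⟩ : a = 0 ∧ b = 0 := by omega
    simp at hcop
  | succ N ih =>
    have key : ∀ a b : ℕ, a ≤ b → a + b ≤ N + 1 → Nat.Coprime a b →
        ∀ z w : A, T q a z = T q b w → ∃ t, T q b t = z ∧ T q a t = w := by
      intro a b hle hab hcop z w hzw
      rcases Nat.eq_zero_or_pos a with rfl | ha
      · obtain rfl : b = 1 := by simpa using hcop
        rw [T_zero, T_one] at hzw
        exact ⟨z, T_one z, by rw [T_zero, hzw]⟩
      · obtain ⟨c, rfl⟩ := Nat.exists_eq_add_of_le hle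
        have hcop' : Nat.Coprime a c := by simpa using hcop
        -- One subtraction step of Euclid's algorithm: T_{a+c}(w) = T_c(w) + T_a(w)^(q^c), so the
        -- pair (a, a + c) reduces to (a, c).
        have h1 : T q a (z - w ^ q ^ c) = T q c w := by
          rw [T_sub h, hzw, add_comm a c, T_add_index h, T_pow h]; ring
        obtain ⟨t, ht1, ht2⟩ := ih a c (by omega) hcop' _ _ h1
        refine ⟨t, ?_, ht2⟩
        rw [add_comm a c, T_add_index h, ht1, ht2]; ring
    intro a b hab hcop z w hzw
    rcases le_total a b with hle | hle
    · exact key a b hle hab hcop z w hzw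
    · obtain ⟨t, h1, h2⟩ := key b a hle (by omega) hcop.symm w z hzw.symm
      exact ⟨t, h2, h1⟩

end Additive

/-! ### The functions t, u, w and their relations -/

section Relations

variable {A : Type*} [CommRing A] {q : ℕ}

/-- On the curve `T_{s+r}(y) = T_s(x^{1+q^r}) + T_r(x^{1+q^s})` there is a function `t` with
`T_s(t) = y^{q^s} - x^{1+q^s}` and `T_r(t) = x^{1+q^r} - y`. -/
lemma exists_parameter (h : PowAdditive A q) {s r : ℕ} (hcop : Nat.Coprime r s) {x y : A}
    (hxy : T q (s + r) y = T q s (x ^ (1 + q ^ r)) + T q r (x ^ (1 + q ^ s))) :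
    ∃ t, T q s t = y ^ q ^ s - x ^ (1 + q ^ s) ∧ T q r t = x ^ (1 + q ^ r) - y := by
  -- Since T_{s+r}(y) = T_s(y) + T_r(y^(q^s)), the curve equation says T_r(y^(q^s) − x^(1+q^s)) =
  -- T_s(x^(1+q^r) − y).
  refine exists_T_eq_and_T_eq h _ r s le_rfl hcop _ _ ?_
  rw [T_sub h, T_sub h, T_pow h]
  rw [T_add_index h] at hxy
  linear_combination hxy

/-- The function `u = y x^E - T_{r-s}(t)`, `E = q^{r-s} - 1`, satisfies
`u^{q^s} = y + (1 + x^{q^s E}) T_s(t)`. -/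
lemma pow_of_eq_sub_T (h : PowAdditive A q) {s k E : ℕ} {x y t u : A} (hE : E + 1 = q ^ k)
    (h1 : T q s t = y ^ q ^ s - x ^ (1 + q ^ s))
    (h2 : T q (s + k) t = x ^ (1 + q ^ (s + k)) - y)
    (hu : u = y * x ^ E - T q k t) :
    u ^ q ^ s = y + (1 + x ^ (q ^ s * E)) * T q s t := by
  have h3 := T_add_index h s k t
  have h4 : q ^ (s + k) = q ^ s * E + q ^ s := by rw [pow_add, ← hE]; ring
  rw [hu, h.sub_pow, mul_pow, ← pow_mul x, mul_comm E]
  -- This factorization makes the dominant terms of (y x^E)^(q^s) and T_k(t)^(q^s) cancel, which is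
  -- the reason for the choice of u.
  have h5 : x ^ (1 + q ^ (s + k)) = x ^ (q ^ s * E) * x ^ (1 + q ^ s) := by
    rw [h4, ← pow_add]; congr 1; ring
  rw [h5] at h2
  linear_combination h3 - h2 - x ^ (q ^ s * E) * h1

/-- Iterating the relation `u^q = t x^{qE} + u x^{(q-1)E} + w`. -/
lemma iterate_pow_relation (h : PowAdditive A q) {E s : ℕ} {x t u w : A} (hq : 1 ≤ q)
    (hw : u ^ q = t * x ^ (q * E) + u * x ^ ((q - 1) * E) + w) (i : ℕ) (hi : i ≤ s) :
    u ^ q ^ i * x ^ ((q ^ s - q ^ i) * E) = u * x ^ ((q ^ s - 1) * E) + x ^ (q ^ s * E) * T q i t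
      + ∑ j ∈ Finset.range i, w ^ q ^ j * x ^ ((q ^ s - q ^ (j + 1)) * E) := by
  induction i with
  | zero => simp [T_zero]
  | succ i ih =>
    have hle : q ^ (i + 1) ≤ q ^ s := Nat.pow_le_pow_right hq hi
    have hle' : q ^ i ≤ q ^ (i + 1) := Nat.pow_le_pow_right hq (by omega)
    have hu : u ^ q ^ (i + 1) = t ^ q ^ i * x ^ (q ^ (i + 1) * E)
        + u ^ q ^ i * x ^ ((q ^ (i + 1) - q ^ i) * E) + w ^ q ^ i := by
      have e : (q - 1) * E * q ^ i = (q ^ (i + 1) - q ^ i) * E := by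
        rw [show q ^ (i + 1) - q ^ i = (q - 1) * q ^ i by
          rw [Nat.sub_mul, one_mul, pow_succ']]; ring
      rw [pow_succ' q i, pow_mul, hw, h.add_pow, h.add_pow, mul_pow, mul_pow, ← pow_mul, ← pow_mul,
        e, pow_succ' q i]
      ring_nf
    have e1 : x ^ (q ^ (i + 1) * E) * x ^ ((q ^ s - q ^ (i + 1)) * E) = x ^ (q ^ s * E) := by
      rw [← pow_add, ← add_mul, Nat.add_sub_cancel' hle]
    have e2 : x ^ ((q ^ (i + 1) - q ^ i) * E) * x ^ ((q ^ s - q ^ (i + 1)) * E)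
        = x ^ ((q ^ s - q ^ i) * E) := by
      rw [← pow_add, ← add_mul]; congr 2; omega
    rw [Finset.sum_range_succ, T_succ]
    have := ih (by omega)
    rw [hu]
    linear_combination this + t ^ q ^ i * e1 + u ^ q ^ i * e2

/-- The generators `t, u, w` of the ring of functions without poles outside infinity and the four
relations that determine the pole orders. -/
lemma exists_generators (h : PowAdditive A q) (hq : 1 ≤ q) {σ d E : ℕ} (hE : E + 1 = q ^ (d + 1))
    (hcop : Nat.Coprime (σ + 1 + (d + 1)) (σ + 1)) {x y : A}
    (hxy : T q (σ + 1 + (σ + 1 + (d + 1))) y = T q (σ + 1) (x ^ (1 + q ^ (σ + 1 + (d + 1))))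
      + T q (σ + 1 + (d + 1)) (x ^ (1 + q ^ (σ + 1)))) :
    ∃ t u w : A,
      y ^ q ^ (σ + 1) = x ^ (1 + q ^ (σ + 1)) + T q (σ + 1) t ∧
      t ^ q ^ d = x ^ E * y - (T q d t + u) ∧
      u ^ q = x ^ (q * E) * t + (x ^ ((q - 1) * E) * u + w) ∧
      w ^ q ^ σ = - (x ^ ((q ^ (σ + 1) - 1) * E) * u) + (y + T q (σ + 1) t
        - ∑ j ∈ Finset.range σ, x ^ ((q ^ (σ + 1) - q ^ (j + 1)) * E) * w ^ q ^ j) := by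
  obtain ⟨t, h1, h2⟩ := exists_parameter h hcop hxy
  set u := y * x ^ E - T q (d + 1) t with hu
  have h3 := pow_of_eq_sub_T h hE h1 h2 hu
  set w := u ^ q - t * x ^ (q * E) - u * x ^ ((q - 1) * E) with hw
  have h4 := iterate_pow_relation (s := σ + 1) h hq (w := w) (u := u) (t := t) (E := E) (x := x)
    (by rw [hw]; ring) (σ + 1) le_rfl
  refine ⟨t, u, w, by rw [h1]; ring, ?_, by rw [hw]; ring, ?_⟩
  · rw [hu, T_succ]; ring
  · rw [Finset.sum_range_succ] at h4
    simp only [Nat.sub_self, zero_mul, pow_zero, mul_one] at h4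
    have h5 : ∑ j ∈ Finset.range σ, x ^ ((q ^ (σ + 1) - q ^ (j + 1)) * E) * w ^ q ^ j
      = ∑ j ∈ Finset.range σ, w ^ q ^ j * x ^ ((q ^ (σ + 1) - q ^ (j + 1)) * E) :=
      Finset.sum_congr rfl fun _ _ => mul_comm _ _
    rw [h5]
    linear_combination h3 - h4

end Relations

end CastleCurve

/-! ### Weight filtrations and the valuations they define -/

namespace CastleCurve

open WithZero

section Filtration

variable {K A : Type*} [Field K] [CommRing A] [Algebra K A]

/-- An exhaustive filtration whose jumps are additive under multiplication defines a valuation. -/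
theorem exists_valuation_of_filtration [Nontrivial A] (G : ℕ → Submodule K A) (hmono : Monotone G)
    (hzero : G 0 = ⊥) (hone : (1 : A) ∈ G 1) (hex : ∀ f, ∃ N, f ∈ G N)
    (hmul : ∀ N M f g, f ∈ G (N + 1) → f ∉ G N → g ∈ G (M + 1) → g ∉ G M →
      f * g ∈ G (N + M + 1) ∧ f * g ∉ G (N + M)) :
    ∃ v : Valuation A (WithZero (Multiplicative ℤ)),
      (∀ f (N : ℕ), v f ≤ exp (N : ℤ) ↔ f ∈ G (N + 1)) ∧
      ∀ f (N : ℕ), f ∈ G (N + 1) → f ∉ G N → v f = exp (N : ℤ) := by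
  classical
  have hjump : ∀ f : A, f ≠ 0 → ∃ N, f ∈ G (N + 1) ∧ f ∉ G N := by
    intro f hf
    have h0 : Nat.find (hex f) ≠ 0 := by
      intro h
      have := Nat.find_spec (hex f)
      rw [h, hzero, Submodule.mem_bot] at this
      exact hf this
    obtain ⟨N, hN⟩ := Nat.exists_eq_succ_of_ne_zero h0
    exact ⟨N, by simpa [hN] using Nat.find_spec (hex f), Nat.find_min (hex f) (by omega)⟩
  choose! deg hdeg hdeg' using hjump
  have huniq : ∀ f N, f ∈ G (N + 1) → f ∉ G N → f ≠ 0 ∧ deg f = N := by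
    intro f N h1 h2
    have hf : f ≠ 0 := by rintro rfl; exact h2 (zero_mem _)
    refine ⟨hf, le_antisymm ?_ ?_⟩
    · by_contra! h
      exact hdeg' f hf (hmono h h1)
    · by_contra! h
      exact h2 (hmono h (hdeg f hf))
  let val : A → WithZero (Multiplicative ℤ) := fun f => if f = 0 then 0 else exp (deg f : ℤ)
  have hval : ∀ f (N : ℕ), val f ≤ exp (N : ℤ) ↔ f ∈ G (N + 1) := by
    intro f N
    by_cases hf : f = 0
    · simp [val, hf]
    · simp only [val, hf, if_false, exp_le_exp, Nat.cast_le]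
      refine ⟨fun h => hmono (by omega) (hdeg f hf), fun h => ?_⟩
      by_contra! h'
      exact hdeg' f hf (hmono h' h)
  have hval' : ∀ f (N : ℕ), f ∈ G (N + 1) → f ∉ G N → val f = exp (N : ℤ) := by
    intro f N h1 h2
    obtain ⟨hf, hN⟩ := huniq f N h1 h2
    simp [val, hf, hN]
  have hle : ∀ f (N : ℕ), f ≠ 0 → deg f ≤ N → val f ≤ exp (N : ℤ) := by
    intro f N hf h
    simpa [val, hf] using h
  refine ⟨{ toFun := val
            map_zero' := by simp [val]
            map_one' := ?_
            map_mul' := ?_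
            map_add_le_max' := ?_ }, hval, hval'⟩
  · have := hval' 1 0 hone (by simp [hzero])
    simpa using this
  · intro f g
    by_cases hf : f = 0
    · simp [val, hf]
    by_cases hg : g = 0
    · simp [val, hg]
    obtain ⟨h1, h2⟩ := hmul _ _ f g (hdeg f hf) (hdeg' f hf) (hdeg g hg) (hdeg' g hg)
    rw [hval' _ _ h1 h2]
    simp [val, hf, hg, exp_add]
  · intro f g
    by_cases hf : f = 0
    · simp [val, hf]
    by_cases hg : g = 0
    · simp [val, hg]
    have h1 : val (f + g) ≤ exp ((max (deg f) (deg g) : ℕ) : ℤ) := by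
      rw [hval]
      exact add_mem (hmono (by omega) (hdeg f hf)) (hmono (by omega) (hdeg g hg))
    refine h1.trans ?_
    rcases le_total (deg f) (deg g) with h | h
    · rw [max_eq_right h]; exact le_max_of_le_right (by simp [val, hg])
    · rw [max_eq_left h]; exact le_max_of_le_left (by simp [val, hf])

end Filtration

/-! ### Weighted monomials and their reduction -/

section Monomials

variable {K A ι : Type*} [Field K] [CommRing A] [Algebra K A] [Fintype ι]

/-- The monomial `x^m ∏ g_i^{c_i}` with exponent `(m, c)`. -/
def monomialAt (x : A) (g : ι → A) (m : ℕ × (ι → ℕ)) : A := x ^ m.1 * ∏ i, g i ^ m.2 i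

/-- The weight of an exponent `(m, c)`, where `x` has weight `e` and `g_i` has weight `a_i`. -/
def weight (e : ℕ) (a : ι → ℕ) (m : ℕ × (ι → ℕ)) : ℕ := m.1 * e + ∑ i, m.2 i * a i

variable (K) in
/-- The span of the monomials of weight less than `N`. -/
def weightLT (x : A) (g : ι → A) (e : ℕ) (a : ι → ℕ) (N : ℕ) : Submodule K A :=
  Submodule.span K (monomialAt x g '' {m | weight e a m < N})

/-- The exponents with `c_i < p_i` for all `i`. -/
def Reduced (p : ι → ℕ) (m : ℕ × (ι → ℕ)) : Prop := ∀ i, m.2 i < p i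

variable {x : A} {g : ι → A} {e : ℕ} {a p rk : ι → ℕ}

@[simp] lemma monomialAt_zero : monomialAt x g 0 = 1 := by simp [monomialAt]

lemma monomialAt_add (m m' : ℕ × (ι → ℕ)) :
    monomialAt x g (m + m') = monomialAt x g m * monomialAt x g m' := by
  simp only [monomialAt, Prod.fst_add, Prod.snd_add, Pi.add_apply, pow_add, Finset.prod_mul_distrib]
  ring

@[simp] lemma weight_zero : weight e a 0 = 0 := by simp [weight]

lemma weight_add (m m' : ℕ × (ι → ℕ)) :
    weight e a (m + m') = weight e a m + weight e a m' := by
  simp only [weight, Prod.fst_add, Prod.snd_add, Pi.add_apply, add_mul, Finset.sum_add_distrib]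
  ring

lemma monomialAt_single [DecidableEq ι] (i : ι) (k : ℕ) :
    monomialAt x g (0, Pi.single i k) = g i ^ k := by
  simp only [monomialAt, pow_zero, one_mul]
  rw [Finset.prod_eq_single i]
  · simp
  · intro j _ hj; simp [hj]
  · simp

lemma weight_single [DecidableEq ι] (i : ι) (k : ℕ) :
    weight e a (0, Pi.single i k) = k * a i := by
  simp only [weight, zero_mul, zero_add]
  rw [Finset.sum_eq_single i]
  · simp
  · intro j _ hj; simp [hj]
  · simp

lemma monomialAt_mem_weightLT {m : ℕ × (ι → ℕ)} {N : ℕ} (h : weight e a m < N) :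
    monomialAt x g m ∈ weightLT K x g e a N :=
  Submodule.subset_span ⟨m, h, rfl⟩

lemma weightLT_mono : Monotone (weightLT K x g e a) := fun _ _ h =>
  Submodule.span_mono (Set.image_mono fun _ hm => lt_of_lt_of_le hm h)

lemma weightLT_zero : weightLT K x g e a 0 = ⊥ := by simp [weightLT]

lemma mul_monomialAt_mem_weightLT {f : A} {N : ℕ} (hf : f ∈ weightLT K x g e a N)
    (m : ℕ × (ι → ℕ)) : f * monomialAt x g m ∈ weightLT K x g e a (N + weight e a m) := by
  refine Submodule.span_induction (p := fun f _ => f * monomialAt x g m ∈ weightLT K x g e a _)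
    ?_ ?_ ?_ ?_ hf
  · rintro _ ⟨m', hm', rfl⟩
    rw [← monomialAt_add]
    refine monomialAt_mem_weightLT ?_
    rw [weight_add]
    exact Nat.add_lt_add_right hm' _
  · simp
  · intro f g _ _ hf hg; rw [add_mul]; exact add_mem hf hg
  · intro c f _ hf; rw [smul_mul_assoc]; exact Submodule.smul_mem _ _ hf

/-- The asymmetric indices reflect that a weight at most N plus a weight less than M is less than N
+ M. This is what makes products with a lower-order remainder negligible. -/
lemma mul_mem_weightLT {f h : A} {N M : ℕ} (hf : f ∈ weightLT K x g e a (N + 1))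
    (hh : h ∈ weightLT K x g e a M) : f * h ∈ weightLT K x g e a (N + M) := by
  refine Submodule.span_induction (p := fun h _ => f * h ∈ weightLT K x g e a _)
    ?_ ?_ ?_ ?_ hh
  · rintro _ ⟨m', hm', rfl⟩
    refine weightLT_mono ?_ (mul_monomialAt_mem_weightLT hf m')
    have : weight e a m' < M := hm'
    omega
  · simp
  · intro f g _ _ hf hg; rw [mul_add]; exact add_mem hf hg
  · intro c f _ hf; rw [mul_smul_comm]; exact Submodule.smul_mem _ _ hf

variable (K) in
/-- Rewriting rules for monomials: the power `g_i ^ p_i` is, up to a nonzero constant and terms of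
smaller weight, a monomial of the same weight and of smaller rank. -/
structure RewriteSystem (x : A) (g : ι → A) (e : ℕ) (a p rk : ι → ℕ) : Prop where
  adjoin_eq_top : Algebra.adjoin K (insert x (Set.range g)) = ⊤
  rewrite (i : ι) : ∃ c : K, c ≠ 0 ∧ ∃ d : ℕ × (ι → ℕ), weight e a d = p i * a i ∧
    ∑ j, d.2 j * rk j < p i * rk i ∧ g i ^ p i - c • monomialAt x g d ∈ weightLT K x g e a (p i * a i)
  residue_injective (c c' : ι → ℕ) : (∀ i, c i < p i) → (∀ i, c' i < p i) →
    ∑ i, c i * a i ≡ ∑ i, c' i * a i [MOD e] → c = c'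
  prod_eq : ∏ i, p i = e

namespace RewriteSystem

lemma exists_mem_weightLT (h : RewriteSystem K x g e a p rk) (f : A) :
    ∃ N, f ∈ weightLT K x g e a N := by
  classical
  have hf : f ∈ Algebra.adjoin K (insert x (Set.range g)) := by rw [h.adjoin_eq_top]; trivial
  induction hf using Algebra.adjoin_induction with
  | mem f hf =>
    rcases hf with rfl | ⟨i, rfl⟩
    · refine ⟨weight e a (1, 0) + 1, ?_⟩
      have : f = monomialAt f g (1, 0) := by simp [monomialAt]
      nth_rewrite 2 [this]
      exact monomialAt_mem_weightLT (Nat.lt_succ_self _)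
    · refine ⟨weight e a (0, Pi.single i 1) + 1, ?_⟩
      have : g i = monomialAt x g (0, Pi.single i 1) := by rw [monomialAt_single, pow_one]
      rw [this]
      exact monomialAt_mem_weightLT (Nat.lt_succ_self _)
  | algebraMap c =>
    refine ⟨1, ?_⟩
    rw [Algebra.algebraMap_eq_smul_one, ← monomialAt_zero (x := x) (g := g)]
    exact Submodule.smul_mem _ _ (monomialAt_mem_weightLT (by simp))
  | add f f' _ _ hf hf' =>
    obtain ⟨N, hN⟩ := hf
    obtain ⟨M, hM⟩ := hf'
    exact ⟨max N M, add_mem (weightLT_mono (le_max_left _ _) hN)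
      (weightLT_mono (le_max_right _ _) hM)⟩
  | mul f f' _ _ hf hf' =>
    obtain ⟨N, hN⟩ := hf
    obtain ⟨M, hM⟩ := hf'
    exact ⟨N + M, mul_mem_weightLT (weightLT_mono (Nat.le_succ N) hN) hM⟩

/-- Every monomial is, up to a nonzero constant and terms of smaller weight, a reduced monomial of
the same weight. -/
lemma exists_reduced (h : RewriteSystem K x g e a p rk) (m : ℕ × (ι → ℕ)) :
    ∃ c : K, c ≠ 0 ∧ ∃ m', Reduced p m' ∧ weight e a m' = weight e a m ∧
      monomialAt x g m - c • monomialAt x g m' ∈ weightLT K x g e a (weight e a m) := by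
  classical
  induction hk : ∑ j, m.2 j * rk j using Nat.strong_induction_on generalizing m with
  | _ k ih =>
    by_cases hred : Reduced p m
    · exact ⟨1, one_ne_zero, m, hred, rfl, by simp⟩
    · simp only [Reduced, not_forall, not_lt] at hred
      obtain ⟨i, hi⟩ := hred
      obtain ⟨c, hc, d, hd1, hd2, hd3⟩ := h.rewrite i
      -- Split off one factor g_i^(p_i) and rewrite it. The weight is kept and the rank drops, so
      -- the process terminates even when p_i = 1.
      let m₀ : ℕ × (ι → ℕ) := (m.1, m.2 - Pi.single i (p i))
      have hm : m = (0, Pi.single i (p i)) + m₀ := by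
        ext j
        · simp [m₀]
        · by_cases hj : j = i
          · subst hj; simp [m₀]; omega
          · simp [m₀, hj]
      have hw : weight e a (d + m₀) = weight e a m := by
        conv_rhs => rw [hm]
        rw [weight_add, weight_add, weight_single, hd1]
      have hr : ∑ j, (d + m₀).2 j * rk j < k := by
        rw [← hk]
        conv_rhs => rw [hm]
        simp only [Prod.snd_add, Pi.add_apply, add_mul, Finset.sum_add_distrib]
        have : ∑ j, (Pi.single i (p i) : ι → ℕ) j * rk j = p i * rk i := by
          rw [Finset.sum_eq_single i] <;> simp +contextual
        rw [this]
        omega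
      obtain ⟨c', hc', m', hm', hwm', hmem⟩ := ih _ hr _ rfl
      refine ⟨c * c', mul_ne_zero hc hc', m', hm', by rw [hwm', hw], ?_⟩
      rw [hw] at hmem
      have h1 := mul_monomialAt_mem_weightLT hd3 m₀
      have h2 : p i * a i + weight e a m₀ = weight e a m := by
        conv_rhs => rw [hm]
        rw [weight_add, weight_single]
      rw [h2, sub_mul, smul_mul_assoc, ← monomialAt_add, ← monomialAt_single (x := x),
        ← monomialAt_add, ← hm] at h1
      have h3 := add_mem h1 (Submodule.smul_mem _ c hmem)
      convert h3 using 1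
      rw [smul_sub, mul_smul]
      abel

/-- A monomial of weight N agrees with a multiple of a reduced one of weight N modulo strictly
smaller weights, so induction on N replaces all monomials by reduced ones. -/
lemma weightLT_le (h : RewriteSystem K x g e a p rk) (N : ℕ) :
    weightLT K x g e a N ≤
      Submodule.span K (monomialAt x g '' {m | Reduced p m ∧ weight e a m < N}) := by
  induction N with
  | zero => rw [weightLT_zero]; exact bot_le
  | succ N ih =>
    have hstep : Submodule.span K (monomialAt x g '' {m | Reduced p m ∧ weight e a m < N}) ≤
        Submodule.span K (monomialAt x g '' {m | Reduced p m ∧ weight e a m < N + 1}) :=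
      Submodule.span_mono (Set.image_mono fun m hm => ⟨hm.1, hm.2.trans (Nat.lt_succ_self _)⟩)
    rw [weightLT, Submodule.span_le]
    rintro _ ⟨m, hm, rfl⟩
    obtain ⟨c, hc, m', hm', hw, hmem⟩ := h.exists_reduced m
    have hm : weight e a m < N + 1 := hm
    have h1 := hstep (ih (weightLT_mono (by omega) hmem))
    have h2 : monomialAt x g m' ∈
        Submodule.span K (monomialAt x g '' {m | Reduced p m ∧ weight e a m < N + 1}) :=
      Submodule.subset_span ⟨m', ⟨hm', by omega⟩, rfl⟩
    have h3 := add_mem h1 (Submodule.smul_mem _ c h2)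
    rwa [sub_add_cancel] at h3

/-- The weight modulo e determines the exponents of the g_i, and then the weight itself determines
the exponent of x. -/
lemma reduced_injective (h : RewriteSystem K x g e a p rk) (he : 0 < e) {m m' : ℕ × (ι → ℕ)}
    (hm : Reduced p m) (hm' : Reduced p m') (hw : weight e a m = weight e a m') : m = m' := by
  have h1 : m.2 = m'.2 := by
    refine h.residue_injective _ _ hm hm' ?_
    have : weight e a m % e = weight e a m' % e := by rw [hw]
    simpa [weight, Nat.ModEq] using this
  have h2 : m.1 = m'.1 := by
    simp only [weight, h1, Nat.add_right_cancel_iff] at hw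
    exact Nat.eq_of_mul_eq_mul_right he hw
  exact Prod.ext h2 h1

/-- The reduced monomials are linearly independent if `A` is free of rank `e` over `K[x]`. -/
lemma linearIndependent [Algebra K[X] A] [IsScalarTower K K[X] A]
    (h : RewriteSystem K x g e a p rk) (hx : x = algebraMap K[X] A X)
    (hrank : Module.finrank K[X] A = e) :
    LinearIndependent K (fun m : {m // Reduced p m} => monomialAt x g m.1) := by
  classical
  let b : (∀ i, Fin (p i)) → A := fun c => ∏ i, g i ^ (c i : ℕ)
  have hb : ∀ m (hm : Reduced p m),
      monomialAt x g m = (X ^ m.1 : K[X]) • b fun i => ⟨m.2 i, hm i⟩ := by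
    intro m hm
    simp only [monomialAt, b, Algebra.smul_def, map_pow, ← hx]
  have hspan : ⊤ ≤ Submodule.span K[X] (Set.range b) := by
    intro f _
    obtain ⟨N, hN⟩ := h.exists_mem_weightLT f
    have := h.weightLT_le N hN
    have hle : Submodule.span K (monomialAt x g '' {m | Reduced p m ∧ weight e a m < N}) ≤
        (Submodule.span K[X] (Set.range b)).restrictScalars K := by
      rw [Submodule.span_le]
      rintro _ ⟨m, ⟨hm, -⟩, rfl⟩
      rw [hb m hm]
      exact Submodule.smul_mem _ _ (Submodule.subset_span (Set.mem_range_self _))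
    exact hle this
  -- The spanning family has ∏ p_i = e members, which is the rank, so it is a basis.
  have hli : LinearIndependent K[X] b :=
    linearIndependent_of_top_le_span_of_card_eq_finrank hspan (by
      rw [hrank, ← h.prod_eq]; simp [Fintype.card_pi])
  have hli2 := linearIndependent_smul (Polynomial.basisMonomials K).linearIndependent hli
  let φ : {m // Reduced p m} → ℕ × (∀ i, Fin (p i)) := fun m => (m.1.1, fun i => ⟨m.1.2 i, m.2 i⟩)
  have hφ : Function.Injective φ := by
    rintro ⟨⟨m, c⟩, hm⟩ ⟨⟨m', c'⟩, hm'⟩ heq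
    simp only [φ, Prod.mk.injEq] at heq
    obtain ⟨rfl, h2⟩ := heq
    have : c = c' := funext fun i => by simpa using congrFun h2 i
    subst this
    rfl
  convert hli2.comp φ hφ using 1
  ext m
  simp only [Function.comp_apply, φ, Polynomial.coe_basisMonomials, ← Polynomial.X_pow_eq_monomial]
  exact hb m.1 m.2

end RewriteSystem

end Monomials

end CastleCurve

/-! ### From rewriting systems to weight valuations -/

namespace CastleCurve

open WithZero

/-- A valuation on `A` which behaves like the pole order at a rational point outside of which all
elements of `A` are regular; `S` is its set of values and `x` is a fixed element with pole order
`e`. -/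
structure IsWeightValuation (K : Type*) {A : Type*} [Field K] [CommRing A] [Algebra K A] (x : A)
    (e : ℕ) (S : Set ℕ) (v : Valuation A (WithZero (Multiplicative ℤ))) : Prop where
  exists_mem_of_ne_zero {f : A} : f ≠ 0 → ∃ N ∈ S, v f = exp (N : ℤ)
  exists_of_mem {N : ℕ} : N ∈ S → ∃ f, v f = exp (N : ℤ)
  exists_sub_lt {f g : A} : f ≠ 0 → v f = v g → ∃ c : K, v (f - c • g) < v f
  map_x : v x = exp (e : ℤ)
  exists_finite_span : ∃ B : Set A, B.Finite ∧ ∀ f (N : ℕ), v f ≤ exp (N : ℤ) →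
    f ∈ Submodule.span K {z | ∃ m : ℕ, ∃ b ∈ B, z = x ^ m * b ∧ v z ≤ exp (N : ℤ)}

namespace RewriteSystem

variable {K A ι : Type*} [Field K] [CommRing A] [Algebra K A] [Fintype ι]
  {x : A} {g : ι → A} {e : ℕ} {a p rk : ι → ℕ}

/-- Otherwise the monomial would be a combination of reduced monomials of smaller weight, against
linear independence. -/
lemma monomialAt_notMem (h : RewriteSystem K x g e a p rk)
    (hli : LinearIndependent K (fun m : {m // Reduced p m} => monomialAt x g m.1))
    {m : ℕ × (ι → ℕ)} (hm : Reduced p m) :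
    monomialAt x g m ∉ weightLT K x g e a (weight e a m) := by
  intro hmem
  have h1 := h.weightLT_le _ hmem
  have h2 := hli.notMem_span_image (s := {m' | weight e a m'.1 < weight e a m}) (x := ⟨m, hm⟩)
    (by simp)
  refine h2 ?_
  convert h1 using 2
  ext z
  simp only [Set.mem_image, Set.mem_ofPred_eq, Subtype.exists, exists_and_left, exists_prop]
  constructor
  · rintro ⟨m', h1, h2, h3⟩; exact ⟨m', ⟨h2, h1⟩, h3⟩
  · rintro ⟨m', ⟨h2, h1⟩, h3⟩; exact ⟨m', h1, h2, h3⟩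

/-- At most one reduced monomial has weight N, so each filtration step adds at most one dimension,
spanned by that monomial. -/
lemma exists_leading (h : RewriteSystem K x g e a p rk) (he : 0 < e) {f : A} {N : ℕ}
    (hf : f ∈ weightLT K x g e a (N + 1)) (hf' : f ∉ weightLT K x g e a N) :
    ∃ m, Reduced p m ∧ weight e a m = N ∧ ∃ c : K, c ≠ 0 ∧
      f - c • monomialAt x g m ∈ weightLT K x g e a N := by
  have hdecomp : ∀ f ∈ weightLT K x g e a (N + 1), f ∈ weightLT K x g e a N ∨
      ∃ m, Reduced p m ∧ weight e a m = N ∧ ∃ c : K, c ≠ 0 ∧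
        f - c • monomialAt x g m ∈ weightLT K x g e a N := by
    intro f hf
    refine Submodule.span_induction (p := fun f _ => f ∈ weightLT K x g e a N ∨
      ∃ m, Reduced p m ∧ weight e a m = N ∧ ∃ c : K, c ≠ 0 ∧
        f - c • monomialAt x g m ∈ weightLT K x g e a N) ?_ ?_ ?_ ?_ hf
    · rintro _ ⟨m, hm, rfl⟩
      rcases Nat.lt_succ_iff_lt_or_eq.mp hm with hm | hm
      · exact Or.inl (monomialAt_mem_weightLT hm)
      · obtain ⟨c, hc, m', hm', hw, hmem⟩ := h.exists_reduced m
        exact Or.inr ⟨m', hm', by omega, c, hc, by rwa [hm] at hmem⟩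
    · exact Or.inl (zero_mem _)
    · rintro f f' - - (hf | ⟨m, hm, hw, c, hc, hf⟩) (hf' | ⟨m', hm', hw', c', hc', hf'⟩)
      · exact Or.inl (add_mem hf hf')
      · refine Or.inr ⟨m', hm', hw', c', hc', ?_⟩
        rw [add_sub_assoc]; exact add_mem hf hf'
      · refine Or.inr ⟨m, hm, hw, c, hc, ?_⟩
        rw [add_sub_right_comm]; exact add_mem hf hf'
      · obtain rfl := h.reduced_injective he hm hm' (by omega)
        have hsum := add_mem hf hf'
        rw [sub_add_sub_comm, ← add_smul] at hsum
        by_cases hcc : c + c' = 0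
        · rw [hcc, zero_smul, sub_zero] at hsum; exact Or.inl hsum
        · exact Or.inr ⟨m, hm, hw, c + c', hcc, hsum⟩
    · rintro k f - (hf | ⟨m, hm, hw, c, hc, hf⟩)
      · exact Or.inl (Submodule.smul_mem _ _ hf)
      · by_cases hk : k = 0
        · left; simp [hk]
        · refine Or.inr ⟨m, hm, hw, k * c, mul_ne_zero hk hc, ?_⟩
          rw [mul_smul, ← smul_sub]; exact Submodule.smul_mem _ _ hf
  exact (hdecomp f hf).resolve_left hf'

/-- A rewriting system for the monomials of an algebra that is free of rank `e` over `K[x]` defines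
a weight valuation. -/
theorem exists_isWeightValuation [Nontrivial A] (h : RewriteSystem K x g e a p rk) (he : 0 < e)
    (hli : LinearIndependent K (fun m : {m // Reduced p m} => monomialAt x g m.1)) :
    ∃ v, IsWeightValuation K x e (Set.range (weight e a)) v ∧
      ∀ m, v (monomialAt x g m) = exp (weight e a m : ℤ) := by
  classical
  have hmul : ∀ N M f f', f ∈ weightLT K x g e a (N + 1) → f ∉ weightLT K x g e a N →
      f' ∈ weightLT K x g e a (M + 1) → f' ∉ weightLT K x g e a M →
      f * f' ∈ weightLT K x g e a (N + M + 1) ∧ f * f' ∉ weightLT K x g e a (N + M) := by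
    intro N M f f' hf hf' hg hg'
    refine ⟨mul_mem_weightLT (N := N) (M := M + 1) hf hg, fun hcon => ?_⟩
    -- If the product dropped in weight, so would the product of the leading monomials, and with it
    -- the reduced monomial it rewrites to. That contradicts `monomialAt_notMem`.
    obtain ⟨m, hm, rfl, c, hc, hlt⟩ := h.exists_leading he hf hf'
    obtain ⟨m', hm', rfl, c', hc', hlt'⟩ := h.exists_leading he hg hg'
    obtain ⟨c'', hc'', m'', hm'', hw'', hlt''⟩ := h.exists_reduced (m + m')
    rw [weight_add] at hlt'' hw''
    apply h.monomialAt_notMem hli hm''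
    rw [hw'']
    have h1 : f * (f' - c' • monomialAt x g m') ∈
        weightLT K x g e a (weight e a m + weight e a m') := mul_mem_weightLT hf hlt'
    have h2 : (f - c • monomialAt x g m) * monomialAt x g m' ∈
        weightLT K x g e a (weight e a m + weight e a m') := mul_monomialAt_mem_weightLT hlt m'
    have h3 : (c * c') • monomialAt x g (m + m') ∈
        weightLT K x g e a (weight e a m + weight e a m') := by
      have := sub_mem (sub_mem hcon h1) (Submodule.smul_mem _ c' h2)
      convert this using 1
      rw [monomialAt_add]
      simp only [Algebra.smul_def, map_mul]
      ring
    have h4 : monomialAt x g (m + m') ∈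
        weightLT K x g e a (weight e a m + weight e a m') :=
      (Submodule.smul_mem_iff _ (mul_ne_zero hc hc')).mp h3
    have h5 := sub_mem h4 hlt''
    rw [sub_sub_cancel] at h5
    exact (Submodule.smul_mem_iff _ hc'').mp h5
  obtain ⟨v, hv, hv'⟩ := exists_valuation_of_filtration (weightLT K x g e a) weightLT_mono
    weightLT_zero (by
      rw [← monomialAt_zero (x := x) (g := g)]; exact monomialAt_mem_weightLT (by simp))
    h.exists_mem_weightLT hmul
  have hred : ∀ m, Reduced p m → v (monomialAt x g m) = exp (weight e a m : ℤ) := fun m hm =>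
    hv' _ _ (monomialAt_mem_weightLT (Nat.lt_succ_self _)) (h.monomialAt_notMem hli hm)
  have hlt_of_mem : ∀ f (N : ℕ), f ∈ weightLT K x g e a N → v f < exp (N : ℤ) := by
    intro f N hf
    rcases N with _ | N
    · rw [weightLT_zero, Submodule.mem_bot] at hf
      simp [hf]
    · refine ((hv f N).mpr hf).trans_lt ?_
      rw [exp_lt_exp]; push_cast; omega
  have hmon : ∀ m, v (monomialAt x g m) = exp (weight e a m : ℤ) := by
    intro m
    refine hv' _ _ (monomialAt_mem_weightLT (Nat.lt_succ_self _)) fun hmem => ?_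
    obtain ⟨c, hc, m', hm', hw, hlt⟩ := h.exists_reduced m
    apply h.monomialAt_notMem hli hm'
    have := sub_mem hmem hlt
    rw [sub_sub_cancel] at this
    rw [hw]
    exact (Submodule.smul_mem_iff _ hc).mp this
  have hlead : ∀ f : A, f ≠ 0 → ∃ m, Reduced p m ∧ v f = exp (weight e a m : ℤ) ∧
      ∃ c : K, c ≠ 0 ∧ v (f - c • monomialAt x g m) < v f := by
    intro f hf
    have hex := h.exists_mem_weightLT f
    have h0 : Nat.find hex ≠ 0 := by
      intro h0
      have := Nat.find_spec hex
      rw [h0, weightLT_zero, Submodule.mem_bot] at this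
      exact hf this
    obtain ⟨N, hN⟩ := Nat.exists_eq_succ_of_ne_zero h0
    have h1 : f ∈ weightLT K x g e a (N + 1) := by simpa [hN] using Nat.find_spec hex
    have h2 : f ∉ weightLT K x g e a N := Nat.find_min hex (by omega)
    obtain ⟨m, hm, rfl, c, hc, hlt⟩ := h.exists_leading he h1 h2
    have h3 := hv' _ _ h1 h2
    exact ⟨m, hm, h3, c, hc, h3 ▸ hlt_of_mem _ _ hlt⟩
  refine ⟨v, ⟨?_, ?_, ?_, ?_, ?_⟩, hmon⟩
  · intro f hf
    obtain ⟨m, hm, h1, -⟩ := hlead f hf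
    exact ⟨_, ⟨m, rfl⟩, h1⟩
  · rintro N ⟨m, rfl⟩
    exact ⟨_, hmon m⟩
  · intro f f' hf hff
    have hf' : f' ≠ 0 := by
      rintro rfl
      obtain ⟨m, hm, h1, -⟩ := hlead f hf
      rw [hff, map_zero] at h1
      exact exp_ne_zero h1.symm
    obtain ⟨m, hm, h1, c, hc, h2⟩ := hlead f hf
    obtain ⟨m', hm', h1', c', hc', h2'⟩ := hlead f' hf'
    obtain rfl : m = m' := h.reduced_injective he hm hm' (by
      have : exp (weight e a m : ℤ) = exp (weight e a m' : ℤ) := by rw [← h1, ← h1', hff]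
      simpa using this)
    refine ⟨c / c', ?_⟩
    have hsmul : ∀ (k : K) (z : A), v z < v f → v (k • z) < v f := by
      intro k z hz
      rw [h1] at hz ⊢
      have hmem : z ∈ weightLT K x g e a (weight e a m) := by
        -- In weight 0 the claim is that z = 0, because nonzero elements have value at least 1.
        rcases hwt : weight e a m with _ | N
        · by_contra hz'
          have hz0 : z ≠ 0 := by rintro rfl; exact hz' (zero_mem _)
          obtain ⟨m', -, h3, -⟩ := hlead z hz0
          rw [h3, hwt, exp_lt_exp] at hz
          omega
        · refine (hv z N).mp ?_
          by_cases hz0 : z = 0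
          · simp [hz0]
          obtain ⟨m', -, h3, -⟩ := hlead z hz0
          rw [h3, hwt, exp_lt_exp] at hz
          rw [h3, exp_le_exp]
          push_cast at hz
          omega
      exact hlt_of_mem _ _ (Submodule.smul_mem _ _ hmem)
    have h4 : f - (c / c') • f' = (f - c • monomialAt x g m)
        - (c / c') • (f' - c' • monomialAt x g m) := by
      rw [smul_sub, smul_smul, div_mul_cancel₀ _ hc']; abel
    rw [h4]
    exact (v.map_sub _ _).trans_lt (max_lt h2 (hsmul _ _ (hff ▸ h2')))
  · have : x = monomialAt x g (1, 0) := by simp [monomialAt]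
    rw [this, hmon]
    simp [weight]
  · refine ⟨Set.range fun c : ∀ i, Fin (p i) => ∏ i, g i ^ (c i : ℕ), Set.finite_range _, ?_⟩
    intro f N hf
    refine Submodule.span_mono ?_ (h.weightLT_le _ ((hv f N).mp hf))
    rintro _ ⟨m, ⟨hm, hlt⟩, rfl⟩
    refine ⟨m.1, _, ⟨fun i => ⟨m.2 i, hm i⟩, rfl⟩, rfl, ?_⟩
    rw [hmon, exp_le_exp]
    omega

end RewriteSystem

namespace IsWeightValuation

variable {K A : Type*} [Field K] [CommRing A] [Algebra K A] {x : A} {e : ℕ} {S : Set ℕ}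
  {v : Valuation A (WithZero (Multiplicative ℤ))}

lemma ne_zero (h : IsWeightValuation K x e S v) {f : A} (hf : f ≠ 0) : v f ≠ 0 := by
  obtain ⟨N, -, hN⟩ := h.exists_mem_of_ne_zero hf
  rw [hN]; exact exp_ne_zero

/-- The valuation is multiplicative and vanishes only at 0. Irreducibility of the curve rests on
this. -/
lemma isDomain [Nontrivial A] (h : IsWeightValuation K x e S v) : IsDomain A := by
  have : NoZeroDivisors A := ⟨fun {a b} hab => by
    by_contra! hne
    have := congrArg v hab
    rw [map_mul, map_zero, mul_eq_zero] at this
    exact this.elim (h.ne_zero hne.1) (h.ne_zero hne.2)⟩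
  exact NoZeroDivisors.to_isDomain A

lemma one_le (h : IsWeightValuation K x e S v) {f : A} (hf : f ≠ 0) : 1 ≤ v f := by
  obtain ⟨N, -, hN⟩ := h.exists_mem_of_ne_zero hf
  rw [hN, ← exp_zero, exp_le_exp]; omega

lemma map_algebraMap [Nontrivial A] (h : IsWeightValuation K x e S v) {c : K} (hc : c ≠ 0) :
    v (algebraMap K A c) = 1 := by
  have hinj := (algebraMap K A).injective
  have h1 := h.one_le ((map_ne_zero_iff _ hinj).mpr hc)
  have h2 := h.one_le ((map_ne_zero_iff _ hinj).mpr (inv_ne_zero hc))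
  have h3 : v (algebraMap K A c) * v (algebraMap K A c⁻¹) = 1 := by
    rw [← map_mul, ← map_mul, mul_inv_cancel₀ hc, map_one, map_one]
  refine le_antisymm ?_ h1
  calc v (algebraMap K A c) = v (algebraMap K A c) * 1 := (mul_one _).symm
    _ ≤ v (algebraMap K A c) * v (algebraMap K A c⁻¹) := by gcongr
    _ = 1 := h3

end IsWeightValuation

end CastleCurve

/-! ### Places -/

namespace CastleCurve

open WithZero

/-- Two valuations with value group `ℤ` and the same valuation ring are equal. -/
lemma valuation_eq_of_le_one_iff {F : Type*} [Field F]
    {v w : Valuation F (WithZero (Multiplicative ℤ))} (h : ∀ f, v f ≤ 1 ↔ w f ≤ 1) {π π' : F}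
    (hπ : v π = exp (-1 : ℤ)) (hπ' : w π' = exp (-1 : ℤ)) : v = w := by
  have hlt : ∀ f, v f < 1 ↔ w f < 1 := by
    intro f
    by_cases hf : f = 0
    · simp [hf]
    have h1 := h f⁻¹
    rw [map_inv₀, map_inv₀, inv_le_one₀ (zero_lt_iff.mpr ((map_ne_zero v).mpr hf)),
      inv_le_one₀ (zero_lt_iff.mpr ((map_ne_zero w).mpr hf))] at h1
    rw [← not_le, ← not_le, h1]
  have heq : ∀ f, v f = 1 ↔ w f = 1 := by
    intro f
    rw [le_antisymm_iff, le_antisymm_iff, ← not_lt (b := (1 : WithZero (Multiplicative ℤ))),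
      ← not_lt (a := w f), hlt, h]
  have hπ0 : π ≠ 0 := by rintro rfl; rw [map_zero] at hπ; exact exp_ne_zero hπ.symm
  have hπ0' : π' ≠ 0 := by rintro rfl; rw [map_zero] at hπ'; exact exp_ne_zero hπ'.symm
  have hone : (1 : WithZero (Multiplicative ℤ)) = exp (0 : ℤ) := exp_zero.symm
  have hwπ : w π = exp (-1 : ℤ) := by
    have h1 : w π < 1 := (hlt π).mp (by rw [hπ, hone, exp_lt_exp]; norm_num)
    have h2 : v π' < 1 := (hlt π').mpr (by rw [hπ', hone, exp_lt_exp]; norm_num)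
    obtain ⟨a, ha⟩ : ∃ a : ℤ, w π = exp a := ⟨_, (exp_log ((map_ne_zero w).mpr hπ0)).symm⟩
    obtain ⟨b, hb⟩ : ∃ b : ℤ, v π' = exp b := ⟨_, (exp_log ((map_ne_zero v).mpr hπ0')).symm⟩
    -- As b ≤ −1, the quotient π/π' is not in the maximal ideal of v, hence not in that of w. This
    -- forces a ≥ −1.
    have h3 := hlt (π / π')
    rw [map_div₀, map_div₀, ha, hb, hπ, hπ', ← exp_sub, ← exp_sub, hone, exp_lt_exp,
      exp_lt_exp] at h3
    rw [ha, hone, exp_lt_exp] at h1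
    rw [hb, hone, exp_lt_exp] at h2
    rw [ha, exp_inj]
    omega
  ext f
  by_cases hf : f = 0
  · simp [hf]
  obtain ⟨k, hk⟩ : ∃ a : ℤ, v f = exp a := ⟨_, (exp_log ((map_ne_zero v).mpr hf)).symm⟩
  obtain ⟨l, hl⟩ : ∃ a : ℤ, w f = exp a := ⟨_, (exp_log ((map_ne_zero w).mpr hf)).symm⟩
  -- The exponent k makes this element a unit for v, hence for w.
  have h1 := heq (f * π ^ k)
  simp only [map_mul, map_zpow₀, hk, hl, hπ, hwπ, ← exp_zsmul, ← exp_add, hone, exp_inj] at h1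
  rw [hk, hl, exp_inj]
  simp at h1
  omega

namespace Place

variable {K F : Type*} [Field K] [Field F] [Algebra K F]

lemma ext_ring {P Q : Place K F} (h : P.ring = Q.ring) : P = Q := by
  cases P; cases Q; cases h; rfl

lemma valuation_le_one_iff (P : Place K F) (f : F) : P.valuation f ≤ 1 ↔ f ∈ P.ring := by
  have := P.isDVR
  constructor
  · intro h
    obtain ⟨a, rfl⟩ := IsDiscreteValuationRing.exists_lift_of_le_one h
    exact a.2
  · intro h
    exact (IsDiscreteValuationRing.maximalIdeal P.ring).valuation_le_one (K := F) ⟨f, h⟩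

lemma exists_uniformizer (P : Place K F) : ∃ π, P.valuation π = exp (-1 : ℤ) := by
  have := P.isDVR
  exact (IsDiscreteValuationRing.maximalIdeal P.ring).valuation_exists_uniformizer F

lemma poleOrder_eq_zero_iff (P : Place K F) {f : F} (hf : f ≠ 0) :
    P.poleOrder f = 0 ↔ f ∈ P.ring := by
  rw [← valuation_le_one_iff, poleOrder, ord, neg_neg, Int.toNat_eq_zero]
  obtain ⟨k, hk⟩ : ∃ a : ℤ, P.valuation f = exp a :=
    ⟨_, (exp_log ((map_ne_zero P.valuation).mpr hf)).symm⟩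
  rw [hk, log_exp, ← exp_zero, exp_le_exp]

lemma poleOrder_eq (P : Place K F) {f : F} {m : ℕ} (h : P.valuation f = exp (m : ℤ)) :
    P.poleOrder f = m := by
  rw [poleOrder, ord, h, log_exp]; simp

/-- A discrete valuation ring is maximal among the proper valuation subrings of its fraction field,
and the inverse of a uniformizer shows that the larger ring is proper. -/
lemma eq_of_ring_le {P Q : Place K F} (h : P.ring ≤ Q.ring) : P = Q := by
  have := P.isDVR
  refine ext_ring (ValuationSubring.eq_of_le_of_ne_top _ h ?_)
  intro htop
  obtain ⟨π, hπ⟩ := Q.exists_uniformizer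
  have h1 : π⁻¹ ∈ Q.ring := by rw [htop]; trivial
  rw [← valuation_le_one_iff, map_inv₀, hπ, ← exp_neg, ← exp_zero, exp_le_exp] at h1
  norm_num at h1

lemma algebraMap_valuation (P : Place K F) {c : K} (hc : c ≠ 0) :
    P.valuation (algebraMap K F c) = 1 := by
  have h1 := (P.valuation_le_one_iff _).mpr (P.algebraMap_mem c)
  have h2 := (P.valuation_le_one_iff _).mpr (P.algebraMap_mem c⁻¹)
  refine le_antisymm h1 ?_
  rw [map_inv₀, map_inv₀] at h2
  exact (inv_le_one₀ (zero_lt_iff.mpr (by simpa using hc))).mp h2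

lemma mem_maximalIdeal_iff (P : Place K F) (f : P.ring) :
    f ∈ IsLocalRing.maximalIdeal P.ring ↔ P.valuation f < 1 := by
  have := P.isDVR
  exact ((IsDiscreteValuationRing.maximalIdeal P.ring).valuation_lt_one_iff_mem (K := F) f).symm

/-- A place is rational if and only if every function regular at it is congruent to a constant. -/
lemma isRational_iff (P : Place K F) :
    P.IsRational ↔ ∀ f ∈ P.ring, ∃ c : K, P.valuation (f - algebraMap K F c) < 1 := by
  have key : ∀ (f : P.ring) (c : K), (IsLocalRing.residue P.ring) (P.constants c) =
      IsLocalRing.residue P.ring f ↔ P.valuation ((f : F) - algebraMap K F c) < 1 := by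
    intro f c
    rw [eq_comm, ← sub_eq_zero, ← map_sub, IsLocalRing.residue_eq_zero_iff, mem_maximalIdeal_iff]
    rfl
  constructor
  · intro h f hf
    obtain ⟨c, hc⟩ := h (IsLocalRing.residue P.ring ⟨f, hf⟩)
    exact ⟨c, (key ⟨f, hf⟩ c).mp hc⟩
  · intro h z
    obtain ⟨f, rfl⟩ := IsLocalRing.residue_surjective z
    obtain ⟨c, hc⟩ := h f f.2
    exact ⟨c, (key f c).mpr hc⟩

/-- The place of a valuation with value group `ℤ` that is trivial on the constants. -/
def ofValuation (v : Valuation F (WithZero (Multiplicative ℤ)))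
    (hv : ∃ π, v π = exp (-1 : ℤ)) (hK : ∀ c : K, v (algebraMap K F c) ≤ 1) : Place K F where
  ring := v.valuationSubring
  isDVR := by
    have : Nontrivial (MonoidWithZeroHom.valueGroup (.ofClass v)) := by
      obtain ⟨π, hπ⟩ := hv
      rw [Subgroup.nontrivial_iff_exists_ne_one]
      refine ⟨Units.mk0 (v π) (by simp [hπ]), ?_, ?_⟩
      · apply MonoidWithZeroHom.mem_valueGroup
        exact ⟨π, by simp⟩
      · intro h
        have := congrArg Units.val h
        simp [hπ] at this
    infer_instance
  algebraMap_mem := hK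

lemma ofValuation_valuation (v : Valuation F (WithZero (Multiplicative ℤ)))
    (hv : ∃ π, v π = exp (-1 : ℤ)) (hK : ∀ c : K, v (algebraMap K F c) ≤ 1) :
    (ofValuation v hv hK).valuation = v := by
  obtain ⟨π, hπ⟩ := (ofValuation v hv hK).exists_uniformizer
  obtain ⟨π', hπ'⟩ := hv
  exact valuation_eq_of_le_one_iff (fun f => (valuation_le_one_iff _ f).trans Iff.rfl) hπ hπ'

end Place

end CastleCurve

/-! ### The place at infinity of a weight valuation -/

namespace CastleCurve

open WithZero

namespace IsWeightValuation

variable {K A : Type*} [Field K] [CommRing A] [IsDomain A] [Algebra K A] {x : A} {e : ℕ}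
  {S : Set ℕ} {v : Valuation A (WithZero (Multiplicative ℤ))}
variable (F : Type*) [Field F] [Algebra A F] [IsFractionRing A F]

/-- The extension of a weight valuation to the field of fractions. -/
noncomputable def extend (h : IsWeightValuation K x e S v) :
    Valuation F (WithZero (Multiplicative ℤ)) :=
  v.extendToLocalization (S := nonZeroDivisors A)
    (fun _ hf hf' => h.ne_zero (nonZeroDivisors.ne_zero hf) hf') F

@[simp] lemma extend_algebraMap (h : IsWeightValuation K x e S v) (f : A) :
    h.extend F (algebraMap A F f) = v f :=
  Valuation.extendToLocalization_apply_map_apply _ _ _ _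

variable [Algebra K F] [IsScalarTower K A F]

/-- The place at infinity of a weight valuation whose values generate `ℤ`. -/
noncomputable def place (h : IsWeightValuation K x e S v) (hS : ∃ N ∈ S, N + 1 ∈ S) : Place K F :=
  Place.ofValuation (h.extend F) (by
    obtain ⟨N, hN, hN'⟩ := hS
    obtain ⟨f, hf⟩ := h.exists_of_mem hN
    obtain ⟨g, hg⟩ := h.exists_of_mem hN'
    -- A quotient of functions of consecutive weights N and N + 1 is a uniformizer.
    refine ⟨algebraMap A F f / algebraMap A F g, ?_⟩
    rw [map_div₀, extend_algebraMap, extend_algebraMap, hf, hg, ← exp_sub]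
    congr 1; push_cast; ring) (by
    intro c
    rw [IsScalarTower.algebraMap_apply K A F, extend_algebraMap]
    by_cases hc : c = 0
    · simp [hc]
    · rw [h.map_algebraMap hc])

variable {F}

lemma place_valuation (h : IsWeightValuation K x e S v) (hS : ∃ N ∈ S, N + 1 ∈ S) :
    (h.place F hS).valuation = h.extend F :=
  Place.ofValuation_valuation _ _ _

lemma place_valuation_algebraMap (h : IsWeightValuation K x e S v) (hS : ∃ N ∈ S, N + 1 ∈ S)
    (f : A) : (h.place F hS).valuation (algebraMap A F f) = v f := by
  rw [h.place_valuation, extend_algebraMap]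

/-- A unit at infinity is a quotient a/b of elements of equal weight. Since weight spaces grow by
one dimension, a − c b has smaller weight for some constant c, and c is the residue. -/
lemma place_isRational (h : IsWeightValuation K x e S v) (hS : ∃ N ∈ S, N + 1 ∈ S) :
    (h.place F hS).IsRational := by
  rw [Place.isRational_iff]
  intro f hf
  rw [← Place.valuation_le_one_iff] at hf
  rcases hf.lt_or_eq with hf | hf
  · exact ⟨0, by simpa using hf⟩
  obtain ⟨a, b, hb, rfl⟩ := IsFractionRing.div_surjective A f
  have hb0 : b ≠ 0 := nonZeroDivisors.ne_zero hb
  have hvb := h.ne_zero hb0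
  have hbF : algebraMap A F b ≠ 0 := by simpa using hb0
  rw [map_div₀, place_valuation_algebraMap, place_valuation_algebraMap, div_eq_one_iff_eq hvb] at hf
  have ha0 : a ≠ 0 := by
    rintro rfl
    rw [map_zero] at hf; exact hvb hf.symm
  obtain ⟨c, hc⟩ := h.exists_sub_lt ha0 hf
  refine ⟨c, ?_⟩
  have : algebraMap A F a / algebraMap A F b - algebraMap K F c =
      algebraMap A F (a - c • b) / algebraMap A F b := by
    rw [Algebra.smul_def, map_sub, map_mul, ← IsScalarTower.algebraMap_apply]
    field_simp
  rw [this, map_div₀, place_valuation_algebraMap, place_valuation_algebraMap,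
    div_lt_one₀ (zero_lt_iff.mpr hvb), ← hf]
  exact hc

set_option linter.unusedSectionVars false in
/-- At a place where `x` has a pole, the order of a function is bounded by its weight. -/
lemma valuation_pow_le (h : IsWeightValuation K x e S v) (he : 0 < e) (Q : Place K F)
    (hQ : 1 < Q.valuation (algebraMap A F x)) {f : A} {N : ℕ} (hf : v f ≤ exp (N : ℤ)) :
    Q.valuation (algebraMap A F f) ^ e ≤ Q.valuation (algebraMap A F x) ^ N := by
  set X := Q.valuation (algebraMap A F x) with hX
  have hX0 : X ≠ 0 := (zero_lt_one.trans hQ).ne'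
  obtain ⟨B, hB, hspan⟩ := h.exists_finite_span
  -- The constant M bounds the finitely many module generators at Q. It gives the inequality up to a
  -- factor independent of f and N, which passing to powers of f removes.
  obtain ⟨M, hM⟩ : ∃ M, ∀ b ∈ B, Q.valuation (algebraMap A F b) ^ e ≤ M := by
    obtain ⟨M, hM⟩ := (hB.image fun b => Q.valuation (algebraMap A F b) ^ e).bddAbove
    exact ⟨M, fun b hb => hM ⟨b, hb, rfl⟩⟩
  have hbound : ∀ (f : A) (N : ℕ), v f ≤ exp (N : ℤ) →
      Q.valuation (algebraMap A F f) ^ e ≤ M * X ^ N := by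
    intro f N hf
    refine Submodule.span_induction
      (p := fun f _ => Q.valuation (algebraMap A F f) ^ e ≤ M * X ^ N) ?_ ?_ ?_ ?_ (hspan f N hf)
    · rintro _ ⟨m, b, hb, rfl, hle⟩
      by_cases hb0 : b = 0
      · subst hb0
        rw [mul_zero, map_zero, map_zero, zero_pow he.ne']
        exact zero_le
      · have h1 : m * e ≤ N := by
          rw [map_mul, map_pow, h.map_x] at hle
          have h2 := h.one_le hb0
          have h3 : exp (e : ℤ) ^ m ≤ exp (N : ℤ) := by
            refine le_trans ?_ hle
            exact le_mul_of_one_le_right zero_le h2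
          rw [← exp_nsmul, exp_le_exp] at h3
          have h4 : ((m * e : ℕ) : ℤ) ≤ N := by simpa using h3
          exact_mod_cast h4
        rw [map_mul, map_mul, map_pow, map_pow, mul_pow, ← hX, ← pow_mul, mul_comm]
        exact mul_le_mul' (hM b hb) (pow_le_pow_right₀ hQ.le h1)
    · rw [map_zero, map_zero, zero_pow he.ne']
      exact zero_le
    · intro f g _ _ hf hg
      rw [map_add]
      rcases le_max_iff.mp (Q.valuation.map_add (algebraMap A F f) (algebraMap A F g)) with h1 | h1
      · exact (pow_le_pow_left₀ zero_le h1 e).trans hf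
      · exact (pow_le_pow_left₀ zero_le h1 e).trans hg
    · intro c f _ hf
      rw [Algebra.smul_def, map_mul, map_mul, ← IsScalarTower.algebraMap_apply]
      refine le_trans ?_ hf
      refine pow_le_pow_left₀ zero_le ?_ e
      refine mul_le_of_le_one_left zero_le ?_
      rw [Place.valuation_le_one_iff]
      exact Q.algebraMap_mem c
  by_contra! hlt
  have hXN : 0 < X ^ N := pow_pos (zero_lt_iff.mpr hX0) N
  have h1 : 1 < Q.valuation (algebraMap A F f) ^ e / X ^ N := (one_lt_div₀ hXN).mpr hlt
  -- The bound for f^k has the same constant M, so a ratio above 1 would eventually exceed it.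
  obtain ⟨k, hk⟩ : ∃ k : ℕ, M < (Q.valuation (algebraMap A F f) ^ e / X ^ N) ^ k := by
    obtain ⟨k, hk⟩ := MulArchimedean.arch M h1
    exact ⟨k + 1, hk.trans_lt (pow_lt_pow_right₀ h1 (Nat.lt_succ_self k))⟩
  have h2 := hbound (f ^ k) (N * k) (by
    rw [map_pow]
    refine (pow_le_pow_left₀ zero_le hf k).trans ?_
    rw [← exp_nsmul, exp_le_exp]
    simp [mul_comm])
  rw [map_pow, map_pow, ← pow_mul, mul_comm k e, pow_mul, pow_mul] at h2
  rw [div_pow, lt_div_iff₀ (pow_pos hXN k)] at hk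
  exact absurd h2 (not_le.mpr hk)

/-- At a place where `x` has a pole, the order of a function is determined by its weight. -/
lemma valuation_pow_eq (h : IsWeightValuation K x e S v) (he : 0 < e) (Q : Place K F)
    (hQ : 1 < Q.valuation (algebraMap A F x)) {f : A} {N : ℕ} (hf : v f = exp (N : ℤ)) :
    Q.valuation (algebraMap A F f) ^ e = Q.valuation (algebraMap A F x) ^ N := by
  have hX : 0 < Q.valuation (algebraMap A F x) := zero_lt_one.trans hQ
  have hf0 : f ≠ 0 := by rintro rfl; rw [map_zero] at hf; exact exp_ne_zero hf.symm
  -- Both powers have weight N e, so f^e is a constant times x^N plus a term of smaller weight,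
  -- which `valuation_pow_le` makes negligible at Q.
  have hfe : v (f ^ e) = v (x ^ N) := by
    rw [map_pow, map_pow, hf, h.map_x, ← exp_nsmul, ← exp_nsmul]
    simp [mul_comm]
  obtain ⟨c, hc⟩ := h.exists_sub_lt (pow_ne_zero e hf0) hfe
  have hc0 : c ≠ 0 := by rintro rfl; simp at hc
  set g := f ^ e - c • x ^ N with hg
  have hlt : Q.valuation (algebraMap A F g) < Q.valuation (algebraMap A F x) ^ N := by
    by_cases hg0 : g = 0
    · rw [hg0, map_zero, map_zero]; exact pow_pos hX N
    obtain ⟨M, -, hM⟩ := h.exists_mem_of_ne_zero hg0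
    have h1 := h.valuation_pow_le he Q hQ hM.le
    have h2 : M < N * e := by
      rw [hM, map_pow, hf, ← exp_nsmul, exp_lt_exp] at hc
      have : (M : ℤ) < ((N * e : ℕ) : ℤ) := by
        refine hc.trans_eq ?_
        push_cast
        simp [mul_comm]
      exact_mod_cast this
    refine lt_of_pow_lt_pow_left₀ e zero_le ?_
    rw [← pow_mul]
    exact h1.trans_lt (pow_lt_pow_right₀ hQ h2)
  have hcx : Q.valuation (algebraMap A F (c • x ^ N)) = Q.valuation (algebraMap A F x) ^ N := by
    rw [Algebra.smul_def, map_mul, map_mul, ← IsScalarTower.algebraMap_apply,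
      Q.algebraMap_valuation hc0, one_mul, map_pow, map_pow]
  have hsum : f ^ e = g + c • x ^ N := by rw [hg, sub_add_cancel]
  rw [← map_pow, ← map_pow, hsum, map_add, Valuation.map_add_eq_of_lt_right _ (by rwa [hcx]), hcx]

/-- The place at infinity is the only place where `x` has a pole. -/
lemma eq_place (h : IsWeightValuation K x e S v) (he : 0 < e) (hS : ∃ N ∈ S, N + 1 ∈ S)
    (Q : Place K F) (hQ : algebraMap A F x ∉ Q.ring) : Q = h.place F hS := by
  rw [← Place.valuation_le_one_iff, not_le] at hQ
  -- Inclusion of the local rings suffices. It holds because values at Q are ordered by the weights.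
  refine (Place.eq_of_ring_le ?_).symm
  intro f hf
  rw [← Place.valuation_le_one_iff] at hf ⊢
  obtain ⟨a, b, hb, rfl⟩ := IsFractionRing.div_surjective A f
  have hb0 : b ≠ 0 := nonZeroDivisors.ne_zero hb
  have hbF : algebraMap A F b ≠ 0 := by simpa using hb0
  by_cases ha0 : a = 0
  · simp [ha0]
  obtain ⟨N, -, hN⟩ := h.exists_mem_of_ne_zero ha0
  obtain ⟨M, -, hM⟩ := h.exists_mem_of_ne_zero hb0
  rw [map_div₀, div_le_one₀ (zero_lt_iff.mpr (by simpa using hbF))] at hf ⊢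
  rw [place_valuation_algebraMap, place_valuation_algebraMap, hN, hM, exp_le_exp] at hf
  refine le_of_pow_le_pow_left₀ he.ne' zero_le ?_
  rw [h.valuation_pow_eq he Q hQ hN, h.valuation_pow_eq he Q hQ hM]
  exact pow_le_pow_right₀ hQ.le (by omega)

lemma x_notMem_place (h : IsWeightValuation K x e S v) (he : 0 < e) (hS : ∃ N ∈ S, N + 1 ∈ S) :
    algebraMap A F x ∉ (h.place F hS).ring := by
  rw [← Place.valuation_le_one_iff, place_valuation_algebraMap, h.map_x, ← exp_zero, exp_le_exp]
  omega

/-- All elements of `A` are regular outside the place at infinity. -/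
lemma algebraMap_mem_of_ne (h : IsWeightValuation K x e S v) (he : 0 < e)
    (hS : ∃ N ∈ S, N + 1 ∈ S) (hint : ∀ f : A, ∀ R : ValuationSubring F,
      (∀ c : K, algebraMap K F c ∈ R) → algebraMap A F x ∈ R → algebraMap A F f ∈ R)
    {Q : Place K F} (hQ : Q ≠ h.place F hS) (f : A) : algebraMap A F f ∈ Q.ring := by
  refine hint f Q.ring Q.algebraMap_mem ?_
  by_contra hx
  exact hQ (h.eq_place he hS Q hx)

end IsWeightValuation

/-! ### Semigroup and rational places when A is Dedekind -/

section Dedekind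

variable {K A : Type*} [Field K] [CommRing A] [IsDedekindDomain A] [Algebra K A]
  {F : Type*} [Field F] [Algebra A F] [IsFractionRing A F] [Algebra K F] [IsScalarTower K A F]

/-- The place of a maximal ideal of a Dedekind domain. -/
noncomputable def Place.ofPrime (P : IsDedekindDomain.HeightOneSpectrum A) :
    Place K F :=
  Place.ofValuation (P.valuation F) (P.valuation_exists_uniformizer F) (fun c => by
    rw [IsScalarTower.algebraMap_apply K A F]
    exact P.valuation_le_one _)

lemma Place.ofPrime_valuation (P : IsDedekindDomain.HeightOneSpectrum A) :
    (Place.ofPrime P : Place K F).valuation = P.valuation F :=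
  Place.ofValuation_valuation _ _ _

namespace IsWeightValuation

variable {x : A} {e : ℕ} {S : Set ℕ} {v : Valuation A (WithZero (Multiplicative ℤ))}

/-- The Weierstrass semigroup at infinity is the set of weights. -/
theorem weierstrassSemigroup_place (h : IsWeightValuation K x e S v)
    (he : 0 < e) (hS : ∃ N ∈ S, N + 1 ∈ S) (hint : ∀ f : A, ∀ R : ValuationSubring F,
      (∀ c : K, algebraMap K F c ∈ R) → algebraMap A F x ∈ R → algebraMap A F f ∈ R) :
    (h.place F hS).weierstrassSemigroup = S := by
  ext m
  constructor
  · rintro ⟨f, hf0, rfl, hf⟩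
    -- The primes of A give places where x is regular, hence places other than infinity. So f is
    -- regular at every prime and lies in A.
    obtain ⟨g, rfl⟩ := IsDedekindDomain.HeightOneSpectrum.mem_integers_of_valuation_le_one (R := A) F f (by
      intro P
      rw [← Place.ofPrime_valuation (K := K) P, Place.valuation_le_one_iff,
        ← Place.poleOrder_eq_zero_iff _ hf0]
      refine hf _ fun heq => h.x_notMem_place (F := F) he hS ?_
      rw [← heq, ← Place.valuation_le_one_iff, Place.ofPrime_valuation]
      exact P.valuation_le_one x)
    obtain ⟨N, hN, hvN⟩ := h.exists_mem_of_ne_zero (f := g) (by rintro rfl; simp at hf0)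
    rwa [Place.poleOrder_eq (m := N)]
    rw [place_valuation_algebraMap, hvN]
  · intro hm
    obtain ⟨f, hf⟩ := h.exists_of_mem hm
    have hf0 : f ≠ 0 := by rintro rfl; rw [map_zero] at hf; exact exp_ne_zero hf.symm
    have hfF : algebraMap A F f ≠ 0 := by simpa using hf0
    refine ⟨algebraMap A F f, hfF, Place.poleOrder_eq _ (by
      rw [place_valuation_algebraMap, hf]), fun Q hQ => ?_⟩
    rw [Place.poleOrder_eq_zero_iff _ hfF]
    exact h.algebraMap_mem_of_ne he hS hint hQ f

/-- The rational places other than the place at infinity correspond to the rational points of the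
affine curve. -/
theorem card_isRational (h : IsWeightValuation K x e S v)
    (he : 0 < e) (hS : ∃ N ∈ S, N + 1 ∈ S) (hint : ∀ f : A, ∀ R : ValuationSubring F,
      (∀ c : K, algebraMap K F c ∈ R) → algebraMap A F x ∈ R → algebraMap A F f ∈ R)
    [Finite (A →ₐ[K] K)] :
    Nat.card {Q : Place K F // Q.IsRational} = Nat.card (A →ₐ[K] K) + 1 := by
  have hker : ∀ φ : A →ₐ[K] K, RingHom.ker φ ≠ ⊥ := by
    -- A zero kernel would make x a constant, whose weight is not e > 0.
    intro φ hbot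
    have h1 : x - algebraMap K A (φ x) ∈ RingHom.ker φ := by simp [RingHom.mem_ker]
    rw [hbot, Ideal.mem_bot, sub_eq_zero] at h1
    have h2 := h.map_x
    rw [h1] at h2
    by_cases hc : φ x = 0
    · rw [hc, map_zero, map_zero] at h2; exact exp_ne_zero h2.symm
    · rw [h.map_algebraMap hc, ← exp_zero, exp_inj] at h2
      omega
  let pr : (A →ₐ[K] K) → IsDedekindDomain.HeightOneSpectrum A := fun φ =>
    ⟨RingHom.ker φ, RingHom.ker_isPrime _, hker φ⟩
  have hmem : ∀ (φ : A →ₐ[K] K) (f : A), (pr φ).valuation F (algebraMap A F f) < 1 ↔ φ f = 0 :=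
    fun φ f => (pr φ).valuation_lt_one_iff_mem f
  have hunit : ∀ (φ : A →ₐ[K] K) (f : A), φ f ≠ 0 → (pr φ).valuation F (algebraMap A F f) = 1 := by
    intro φ f hf
    refine le_antisymm ((pr φ).valuation_le_one f) ?_
    rw [← not_lt, hmem]
    exact hf
  have hrat : ∀ φ, (Place.ofPrime (pr φ) : Place K F).IsRational := by
    intro φ
    rw [Place.isRational_iff]
    intro f hf
    rw [← Place.valuation_le_one_iff, Place.ofPrime_valuation] at hf
    obtain ⟨n, ⟨d, hd⟩, hnd⟩ := (pr φ).exists_primeCompl_mul_eq_of_integer f hf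
    have hd : φ d ≠ 0 := hd
    have hd0 : algebraMap A F d ≠ 0 := by
      have : d ≠ 0 := by rintro rfl; simp at hd
      simpa using this
    refine ⟨φ n / φ d, ?_⟩
    have heq : (f - algebraMap K F (φ n / φ d)) * algebraMap A F d =
        algebraMap A F (n - algebraMap K A (φ n / φ d) * d) := by
      rw [sub_mul, hnd, map_sub, map_mul, ← IsScalarTower.algebraMap_apply]
    have h1 : (pr φ).valuation F (algebraMap A F (n - algebraMap K A (φ n / φ d) * d)) < 1 := by
      rw [hmem, map_sub, map_mul, AlgHom.commutes, Algebra.algebraMap_self, RingHom.id_apply,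
        div_mul_cancel₀ _ hd, sub_self]
    rw [← heq, map_mul, hunit φ d hd, mul_one] at h1
    rwa [Place.ofPrime_valuation]
  have hne : ∀ φ, (Place.ofPrime (pr φ) : Place K F) ≠ h.place F hS := by
    intro φ heq
    apply h.x_notMem_place (F := F) he hS
    rw [← heq, ← Place.valuation_le_one_iff, Place.ofPrime_valuation]
    exact (pr φ).valuation_le_one x
  let toPlace : Option (A →ₐ[K] K) → {Q : Place K F // Q.IsRational} := fun o =>
    o.elim ⟨h.place F hS, h.place_isRational hS⟩ fun φ => ⟨Place.ofPrime (pr φ), hrat φ⟩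
  have hinj : Function.Injective toPlace := by
    rintro (_ | φ) (_ | ψ) heq
    · rfl
    · exact absurd (congrArg Subtype.val heq).symm (hne ψ)
    · exact absurd (congrArg Subtype.val heq) (hne φ)
    · congr 1
      have h1 : (Place.ofPrime (pr φ) : Place K F) = Place.ofPrime (pr ψ) :=
        congrArg Subtype.val heq
      ext f
      have h2 : φ (f - algebraMap K A (φ f)) = 0 := by simp
      rw [← hmem, ← Place.ofPrime_valuation (K := K), h1, Place.ofPrime_valuation, hmem] at h2
      rw [map_sub, AlgHom.commutes, sub_eq_zero] at h2
      exact h2.symm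
  have hsurj : Function.Surjective toPlace := by
    rintro ⟨Q, hQ⟩
    by_cases hQi : Q = h.place F hS
    · exact ⟨none, Subtype.ext hQi.symm⟩
    have hreg := h.algebraMap_mem_of_ne he hS hint hQi
    rw [Place.isRational_iff] at hQ
    have huniq : ∀ (f : F) (c c' : K), Q.valuation (f - algebraMap K F c) < 1 →
        Q.valuation (f - algebraMap K F c') < 1 → c = c' := by
      intro f c c' h1 h2
      by_contra hcc
      have h3 := Q.algebraMap_valuation (sub_ne_zero.mpr hcc)
      have h4 : algebraMap K F (c - c') = (f - algebraMap K F c') - (f - algebraMap K F c) := by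
        rw [map_sub]; ring
      have h5 := (Q.valuation.map_sub (f - algebraMap K F c') (f - algebraMap K F c)).trans_lt
        (max_lt h2 h1)
      rw [← h4, h3] at h5
      exact lt_irrefl _ h5
    -- Away from infinity A is regular, so taking residues at Q gives the homomorphism A → K that
    -- corresponds to Q.
    choose c hc using fun f : A => hQ _ (hreg f)
    have hval : ∀ f : A, Q.valuation (algebraMap A F f) ≤ 1 := fun f =>
      (Q.valuation_le_one_iff _).mpr (hreg f)
    have hcK : ∀ k : K, c (algebraMap K A k) = k := fun k =>
      huniq _ _ _ (hc _) (by rw [← IsScalarTower.algebraMap_apply, sub_self, map_zero]; exact zero_lt_one)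
    let φ : A →ₐ[K] K :=
      { toFun := c
        map_one' := by simpa using hcK 1
        map_zero' := by simpa using hcK 0
        map_add' := fun f g => huniq _ _ _ (hc _) (by
          have : algebraMap A F (f + g) - algebraMap K F (c f + c g) =
              (algebraMap A F f - algebraMap K F (c f)) +
              (algebraMap A F g - algebraMap K F (c g)) := by rw [map_add, map_add]; ring
          rw [this]
          exact (Q.valuation.map_add _ _).trans_lt (max_lt (hc f) (hc g)))
        map_mul' := fun f g => huniq _ _ _ (hc _) (by
          have : algebraMap A F (f * g) - algebraMap K F (c f * c g) =
              (algebraMap A F f - algebraMap K F (c f)) * algebraMap A F g +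
              algebraMap K F (c f) * (algebraMap A F g - algebraMap K F (c g)) := by
            rw [map_mul, map_mul]; ring
          rw [this]
          refine (Q.valuation.map_add _ _).trans_lt (max_lt ?_ ?_)
          · rw [map_mul]
            exact (mul_le_of_le_one_right zero_le (hval g)).trans_lt (hc f)
          · rw [map_mul]
            exact (mul_le_of_le_one_left zero_le
              ((Q.valuation_le_one_iff _).mpr (Q.algebraMap_mem _))).trans_lt (hc g))
        commutes' := hcK }
    refine ⟨some φ, Subtype.ext (Place.eq_of_ring_le ?_)⟩
    intro f hf
    rw [← Place.valuation_le_one_iff] at hf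
    change (Place.ofPrime (pr φ) : Place K F).valuation f ≤ 1 at hf
    rw [Place.ofPrime_valuation] at hf
    obtain ⟨n, ⟨d, hd⟩, hnd⟩ := (pr φ).exists_primeCompl_mul_eq_of_integer f hf
    have hd : c d ≠ 0 := hd
    have hvd : Q.valuation (algebraMap A F d) = 1 := by
      refine le_antisymm (hval d) ?_
      by_contra! hlt
      exact hd (huniq (algebraMap A F d) _ _ (hc d) (by simpa using hlt))
    have h1 := congrArg Q.valuation hnd
    rw [map_mul, hvd, mul_one] at h1
    rw [← Place.valuation_le_one_iff, h1]
    exact hval n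
  rw [← Nat.card_eq_of_bijective toPlace ⟨hinj, hsurj⟩, Finite.card_option]

end IsWeightValuation

end Dedekind

end CastleCurve

/-! ### The coordinate ring -/

namespace CastleCurve

/-- If a monic polynomial over a Dedekind domain has derivative `1`, then the ring obtained by
adjoining a root is Dedekind, provided it is a domain. -/
theorem isDedekindDomain_adjoinRoot {R : Type*} [CommRing R] [IsDedekindDomain R] {P : R[X]}
    (hP : P.Monic) (hd : derivative P = 1) (hdeg : P.degree ≠ 0) [IsDomain (AdjoinRoot P)] :
    IsDedekindDomain (AdjoinRoot P) := by
  have hi : Function.Injective (algebraMap R (AdjoinRoot P)) :=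
    AdjoinRoot.of.injective_of_degree_ne_zero hdeg
  have : FaithfulSMul R (AdjoinRoot P) := (faithfulSMul_iff_algebraMap_injective _ _).mpr hi
  let L := FractionRing (AdjoinRoot P)
  let k := FractionRing R
  let : Algebra k L := FractionRing.liftAlgebra R L
  have : IsScalarTower R k L := inferInstance
  have : Module.Finite R (AdjoinRoot P) := hP.finite_adjoinRoot
  have : FiniteDimensional k L := .of_isLocalization R (AdjoinRoot P) (nonZeroDivisors R)
  have hinjL : Function.Injective (algebraMap (AdjoinRoot P) L) := IsFractionRing.injective _ _
  set y : L := algebraMap (AdjoinRoot P) L (AdjoinRoot.root P) with hy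
  have hyP : aeval y P = 0 := by
    rw [hy, aeval_algebraMap_apply, AdjoinRoot.aeval_eq, AdjoinRoot.mk_self, map_zero]
  have hyR : IsIntegral R y := ⟨P, hP, by rwa [← aeval_def]⟩
  have hAdj : ∀ b : L, b ∈ Algebra.adjoin R {y} ↔ ∃ a, algebraMap (AdjoinRoot P) L a = b := by
    intro b
    have h1 : Algebra.adjoin R {y} = (⊤ : Subalgebra R (AdjoinRoot P)).map
        (IsScalarTower.toAlgHom R (AdjoinRoot P) L) := by
      rw [← AdjoinRoot.adjoinRoot_eq_top, AlgHom.map_adjoin]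
      simp [hy]
    rw [h1]
    simp
  have htop' : IntermediateField.adjoin k {y} = ⊤ := by
    rw [eq_top_iff]
    have hA : ∀ a, algebraMap (AdjoinRoot P) L a ∈ IntermediateField.adjoin k {y} := by
      intro a
      have h1 : Algebra.adjoin R {y} ≤
          (IntermediateField.adjoin k {y}).toSubalgebra.restrictScalars R :=
        Algebra.adjoin_le (by
          rintro _ rfl
          exact IntermediateField.mem_adjoin_simple_self k y)
      exact h1 ((hAdj _).mpr ⟨a, rfl⟩)
    intro b _
    obtain ⟨a, s, -, rfl⟩ := IsFractionRing.div_surjective (AdjoinRoot P) b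
    exact div_mem (hA a) (hA s)
  have htop : Algebra.adjoin k {y} = ⊤ := IntermediateField.adjoin_eq_top_iff.mp htop'
  have hsep : (P.map (algebraMap R k)).Separable := by
    rw [Polynomial.separable_def, derivative_map, hd, Polynomial.map_one]
    exact isCoprime_one_right
  have hysep : IsSeparable k y :=
    hsep.of_dvd (minpoly.dvd k y (by rw [aeval_map_algebraMap, hyP]))
  have : Algebra.IsSeparable k L := by
    have h1 := (IntermediateField.isSeparable_adjoin_simple_iff_isSeparable k L).mpr hysep
    rw [htop'] at h1
    exact Algebra.IsSeparable.of_algHom k (⊤ : IntermediateField k L)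
      (IntermediateField.topEquiv (F := k) (E := L)).symm.toAlgHom
  have hdual := traceForm_dualSubmodule_adjoin R k htop hyR
  -- Traces of integral elements lie in R, so the integral closure lies in the trace dual of R[y].
  -- That dual is R[y] divided by the derivative of the minimal polynomial at y.
  have : IsIntegralClosure (AdjoinRoot P) R L := by
    refine ⟨hinjL, fun {b} => ⟨fun hb => ?_, ?_⟩⟩
    · have hmem : b ∈ (Algebra.traceForm k L).dualSubmodule
          (Subalgebra.toSubmodule (Algebra.adjoin R {y})) := by
        rw [LinearMap.BilinForm.mem_dualSubmodule]
        intro a ha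
        rw [Subalgebra.mem_toSubmodule, hAdj] at ha
        obtain ⟨a, rfl⟩ := ha
        have h1 : IsIntegral R (b * algebraMap (AdjoinRoot P) L a) :=
          hb.mul ((Algebra.IsIntegral.isIntegral a).algebraMap)
        have h2 := Algebra.isIntegral_trace (L := k) h1
        obtain ⟨c, hc⟩ := IsIntegrallyClosed.isIntegral_iff.mp h2
        rw [Algebra.traceForm_apply, ← hc, Submodule.mem_one]
        exact ⟨c, rfl⟩
      -- Differentiating P = minpoly · h at y gives 1 = minpoly'(y) h(y), so the inverse different
      -- is contained in R[y].
      obtain ⟨h, hh⟩ := minpoly.isIntegrallyClosed_dvd hyR hyP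
      have hmin : minpoly k y = (minpoly R y).map (algebraMap R k) :=
        minpoly.isIntegrallyClosed_eq_field_fractions' k hyR
      have hunit : aeval y (derivative (minpoly k y)) * aeval y h = 1 := by
        have h1 := congrArg derivative hh
        rw [hd, derivative_mul] at h1
        have h2 := congrArg (aeval y) h1
        rw [map_one, map_add, map_mul, map_mul, minpoly.aeval, zero_mul, add_zero] at h2
        rw [hmin, derivative_map, aeval_map_algebraMap]
        exact h2.symm
      rw [hdual, inv_eq_of_mul_eq_one_right hunit] at hmem
      obtain ⟨a, ha, rfl⟩ := hmem
      refine (hAdj _).mp ?_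
      refine mul_mem ?_ ha
      rw [hy, aeval_algebraMap_apply]
      exact (hAdj _).mpr ⟨_, rfl⟩
    · rintro ⟨a, rfl⟩
      exact (Algebra.IsIntegral.isIntegral a).algebraMap
  exact IsIntegralClosure.isDedekindDomain R k L (AdjoinRoot P)

end CastleCurve

namespace CastleCurve

/-! ### The polynomials f_r(X) and T_n(Y) − f_r(X) -/

section CurvePoly

variable (K : Type*) [Field K] {q : ℕ}

lemma map_T {A B : Type*} [Semiring A] [Semiring B] (φ : A →+* B) (n : ℕ) (z : A) :
    φ (T q n z) = T q n (φ z) := by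
  simp [T]

lemma degree_X_pow_modulus (hq : 2 ≤ q) {n : ℕ} (hn : 1 ≤ n) :
    (X ^ q ^ n - X : K[X]).Monic ∧ (X ^ q ^ n - X : K[X]).degree = (q ^ n : ℕ) := by
  have h1 : 1 < q ^ n := Nat.one_lt_pow (by omega) hq
  have h2 : (X : K[X]).degree < (q ^ n : ℕ) := by rw [degree_X]; exact_mod_cast h1
  refine ⟨monic_X_pow_sub h2, ?_⟩
  rw [degree_sub_eq_left_of_degree_lt (by rwa [degree_X_pow]), degree_X_pow]

lemma T_X_pow_mem_degreeLT {m k N : ℕ} (h : ∀ i < m, k * q ^ i < N) :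
    T q m ((X : K[X]) ^ k) ∈ degreeLT K N := by
  refine Submodule.sum_mem _ fun i hi => ?_
  rw [mem_degreeLT, ← pow_mul, degree_X_pow]
  exact_mod_cast h i (Finset.mem_range.mp hi)

/-- For i = s + j the term x^((1+q^r) q^i) equals x^(q^(s+j)) (x^(q^n))^(q^j), which reduces to
(x^(1+q^s))^(q^j). All remaining exponents are below q^n, because q^i + q^(b+i) < 2 q^(b+i) ≤
q^(a+b) when i < a and b ≥ 1. -/
lemma fPoly_eq (hq : 2 ≤ q) {s r : ℕ} (hs : 1 ≤ s) (hr : 1 ≤ r) :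
    fPoly K q (s + r) r = T q s (X ^ (1 + q ^ r)) + T q r (X ^ (1 + q ^ s)) := by
  obtain ⟨hmonic, hdeg⟩ := degree_X_pow_modulus K hq (n := s + r) (by omega)
  have hpow : ∀ {a b : ℕ}, a ≤ b → q ^ a ≤ q ^ b := fun h => Nat.pow_le_pow_right (by omega) h
  have hbound : ∀ a b i : ℕ, 1 ≤ b → i < a → (1 + q ^ b) * q ^ i < q ^ (a + b) := by
    intro a b i hb hi
    have h1 : q ^ i < q ^ (b + i) := Nat.pow_lt_pow_right (by omega) (by omega)
    have h2 : q ^ (b + i) * 2 ≤ q ^ (a + b) :=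
      (Nat.mul_le_mul_left _ hq).trans (by rw [← pow_succ]; exact hpow (by omega))
    calc (1 + q ^ b) * q ^ i = q ^ i + q ^ (b + i) := by rw [pow_add]; ring
      _ < q ^ (a + b) := by omega
  have hlt : T q s ((X : K[X]) ^ (1 + q ^ r)) + T q r (X ^ (1 + q ^ s)) ∈
      degreeLT K (q ^ (s + r)) :=
    add_mem (T_X_pow_mem_degreeLT K fun i hi => hbound s r i hr hi)
      (T_X_pow_mem_degreeLT K fun i hi => by rw [add_comm s r]; exact hbound r s i hs hi)
  have hdvd : (X ^ q ^ (s + r) - X : K[X]) ∣ T q (s + r) (X ^ (1 + q ^ r)) -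
      (T q s (X ^ (1 + q ^ r)) + T q r (X ^ (1 + q ^ s))) := by
    have : T q (s + r) ((X : K[X]) ^ (1 + q ^ r)) -
        (T q s (X ^ (1 + q ^ r)) + T q r (X ^ (1 + q ^ s))) =
        ∑ i ∈ Finset.range r, X ^ (q ^ s * q ^ i) * ((X ^ q ^ (s + r)) ^ q ^ i - X ^ q ^ i) := by
      simp only [T, Finset.sum_range_add, add_sub_add_left_eq_sub, ← Finset.sum_sub_distrib]
      refine Finset.sum_congr rfl fun i _ => ?_
      rw [mul_sub, ← pow_mul, ← pow_mul, ← pow_mul, ← pow_add, ← pow_add]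
      congr 2 <;> ring
    rw [this]
    exact Finset.dvd_sum fun i _ => Dvd.dvd.mul_left (sub_dvd_pow_sub_pow _ _ _) _
  obtain ⟨c, hc⟩ := hdvd
  refine (div_modByMonic_unique c _ hmonic ⟨?_, ?_⟩).2
  · rw [← hc]; ring
  · rw [hdeg]; exact mem_degreeLT.mp hlt

lemma eval_fPoly {n r : ℕ} {a : K} (ha : a ^ q ^ n = a) :
    (fPoly K q n r).eval a = T q n (a ^ (1 + q ^ r)) := by
  have h := modByMonic_add_div (T q n ((X : K[X]) ^ (1 + q ^ r))) (X ^ q ^ n - X)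
  have h1 := congrArg (eval a) h
  rw [eval_add, eval_mul] at h1
  simp only [eval_sub, eval_pow, eval_X, ha, sub_self, zero_mul, add_zero] at h1
  rw [fPoly, h1, ← coe_evalRingHom, map_T]
  simp

lemma map_fPoly {L : Type*} [Field L] (φ : K →+* L) (hq : 2 ≤ q) {n : ℕ} (r : ℕ) (hn : 1 ≤ n) :
    (fPoly K q n r).map φ = fPoly L q n r := by
  rw [fPoly, fPoly, map_modByMonic _ (degree_X_pow_modulus K hq hn).1, ← coe_mapRingHom, map_T]
  simp

/-- Division by a monic polynomial commutes with field extension, so geometric irreducibility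
concerns the same family over the algebraic closure. -/
lemma map_curvePoly {L : Type*} [Field L] (φ : K →+* L) (hq : 2 ≤ q) {n : ℕ} (r : ℕ)
    (hn : 1 ≤ n) : (curvePoly K q n r).map (mapRingHom φ) = curvePoly L q n r := by
  rw [curvePoly, curvePoly, ← coe_mapRingHom, map_sub, map_T]
  simp [map_fPoly K φ hq r hn]

lemma curvePoly_monic (hq : 2 ≤ q) (m r : ℕ) : (curvePoly K q (m + 1) r).Monic ∧
    (curvePoly K q (m + 1) r).natDegree = q ^ m := by
  have h : curvePoly K q (m + 1) r =
      X ^ q ^ m + (T q m (X : K[X][X]) - C (fPoly K q (m + 1) r)) := by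
    rw [curvePoly, T_succ]; ring
  have hlt : (T q m (X : K[X][X]) - C (fPoly K q (m + 1) r)).degree < (q ^ m : ℕ) := by
    rw [← mem_degreeLT]
    refine sub_mem (Submodule.sum_mem _ fun i hi => ?_) ?_
    · rw [mem_degreeLT, degree_X_pow]
      exact_mod_cast Nat.pow_lt_pow_right hq (Finset.mem_range.mp hi)
    · rw [mem_degreeLT]
      exact degree_C_le.trans_lt (by exact_mod_cast pow_pos (by omega : 0 < q) m)
  rw [h]
  refine ⟨monic_X_pow_add hlt, ?_⟩
  rw [natDegree_add_eq_left_of_degree_lt (by rwa [degree_X_pow]), natDegree_X_pow]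

/-- Every exponent q^i with i ≥ 1 vanishes in K, so only the linear term survives. This is
smoothness of the affine curve. -/
lemma derivative_curvePoly (hq0 : (q : K) = 0) (m r : ℕ) :
    derivative (curvePoly K q (m + 1) r) = 1 := by
  have h : ∀ i, derivative ((X : K[X][X]) ^ q ^ (i + 1)) = 0 := by
    intro i
    rw [derivative_X_pow, pow_succ]
    have : (C ((q ^ i * q : ℕ) : K[X])) = (0 : K[X][X]) := by
      have : (q : K[X]) = C (q : K) := by simp
      push_cast
      rw [this, hq0]; simp
    rw [this, zero_mul]
  rw [curvePoly, T, derivative_sub, derivative_C, sub_zero, Finset.sum_range_succ', derivative_add,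
    derivative_sum, Finset.sum_eq_zero fun i _ => h i]
  simp

end CurvePoly

/-! ### Generators, integrality and points of the coordinate ring -/

section CoordinateRing

variable (K : Type*) [Field K] (q n r : ℕ)

/-- The coordinate function `x` in the coordinate ring. -/
noncomputable def xCoord : CoordinateRing K q n r := AdjoinRoot.of _ X

/-- The coordinate function `y` in the coordinate ring. -/
noncomputable def yCoord : CoordinateRing K q n r := AdjoinRoot.root _

lemma xCoord_eq : xCoord K q n r = algebraMap K[X] (CoordinateRing K q n r) X := rfl

lemma algebraMap_eq_aeval (f : K[X]) :
    algebraMap K[X] (CoordinateRing K q n r) f = aeval (xCoord K q n r) f := by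
  rw [xCoord_eq, aeval_algebraMap_apply, aeval_X_left_apply]

lemma T_yCoord : T q n (yCoord K q n r) = aeval (xCoord K q n r) (fPoly K q n r) := by
  have h : T q n (X : K[X][X]) = curvePoly K q n r + C (fPoly K q n r) := by
    rw [curvePoly, sub_add_cancel]
  have h1 := congrArg (eval₂RingHom (AdjoinRoot.of (curvePoly K q n r)) (yCoord K q n r)) h
  rw [map_add, map_T, coe_eval₂RingHom, eval₂_X, eval₂_C, yCoord, AdjoinRoot.eval₂_root,
    zero_add] at h1
  rw [← algebraMap_eq_aeval]
  exact h1

lemma adjoin_coord :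
    Algebra.adjoin K {xCoord K q n r, yCoord K q n r} = (⊤ : Subalgebra K (CoordinateRing K q n r)) := by
  set B := Algebra.adjoin K {xCoord K q n r, yCoord K q n r} with hB
  have hx : xCoord K q n r ∈ B := Algebra.subset_adjoin (by simp)
  have hy : yCoord K q n r ∈ B := Algebra.subset_adjoin (by simp)
  rw [eq_top_iff]
  intro f _
  induction f using AdjoinRoot.induction_on with
  | ih p =>
    rw [← AdjoinRoot.aeval_eq, aeval_eq_sum_range]
    refine sum_mem fun i _ => ?_
    rw [Algebra.smul_def, algebraMap_eq_aeval]
    refine mul_mem ?_ (pow_mem hy i)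
    exact Algebra.adjoin_mono (by simp) (aeval_mem_adjoin_singleton K (xCoord K q n r))

variable {K q n r}

lemma finrank_coordinateRing (hq : 2 ≤ q) (m r : ℕ) :
    Module.finrank K[X] (CoordinateRing K q (m + 1) r) = q ^ m := by
  obtain ⟨h1, h2⟩ := curvePoly_monic K hq m r
  rw [(AdjoinRoot.powerBasis' h1).finrank, AdjoinRoot.powerBasis'_dim, h2]

lemma nontrivial_coordinateRing (hq : 2 ≤ q) (m r : ℕ) :
    Nontrivial (CoordinateRing K q (m + 1) r) := by
  obtain ⟨h1, h2⟩ := curvePoly_monic K hq m r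
  refine AdjoinRoot.nontrivial _ ?_
  rw [degree_eq_natDegree h1.ne_zero, h2]
  exact_mod_cast (pow_pos (by omega : 0 < q) m).ne'

lemma irreducible_of_isDomain_adjoinRoot {R : Type*} [CommRing R] [IsDomain R] {P : R[X]}
    (hP : P ≠ 0) [h : IsDomain (AdjoinRoot P)] : Irreducible P := by
  have h1 : (Ideal.span {P}).IsPrime := (Ideal.Quotient.isDomain_iff_prime _).mp h
  exact ((Ideal.span_singleton_prime hP).mp h1).irreducible

lemma isDedekindDomain_coordinateRing (hq : 2 ≤ q) (hq0 : (q : K) = 0) (m r : ℕ)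
    [IsDomain (CoordinateRing K q (m + 1) r)] :
    IsDedekindDomain (CoordinateRing K q (m + 1) r) := by
  obtain ⟨h1, h2⟩ := curvePoly_monic K hq m r
  refine isDedekindDomain_adjoinRoot h1 (derivative_curvePoly K hq0 m r) ?_
  rw [degree_eq_natDegree h1.ne_zero, h2]
  exact_mod_cast (pow_pos (by omega : 0 < q) m).ne'

/-- A valuation ring that contains the constants and `x` contains all of the coordinate ring. -/
lemma algebraMap_mem_valuationSubring (hq : 2 ≤ q) (m r : ℕ) {F : Type*} [Field F]
    [Algebra (CoordinateRing K q (m + 1) r) F] [Algebra K F]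
    [IsScalarTower K (CoordinateRing K q (m + 1) r) F]
    (f : CoordinateRing K q (m + 1) r) (R : ValuationSubring F)
    (hK : ∀ c : K, algebraMap K F c ∈ R) (hx : algebraMap _ F (xCoord K q (m + 1) r) ∈ R) :
    algebraMap _ F f ∈ R := by
  have : Module.Finite K[X] (CoordinateRing K q (m + 1) r) :=
    (curvePoly_monic K hq m r).1.finite_adjoinRoot
  have hf : IsIntegral K[X] f := Algebra.IsIntegral.isIntegral f
  let ψ : K[X] →+* F := (algebraMap (CoordinateRing K q (m + 1) r) F).comp
    (algebraMap K[X] (CoordinateRing K q (m + 1) r))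
  have hψ : ∀ p, ψ p ∈ R.toSubring := by
    intro p
    have h1 : ψ p = aeval (algebraMap _ F (xCoord K q (m + 1) r)) p := by
      simp only [ψ, RingHom.comp_apply]
      rw [algebraMap_eq_aeval, aeval_algebraMap_apply]
    rw [h1, aeval_eq_sum_range]
    refine sum_mem fun i _ => ?_
    rw [Algebra.smul_def]
    exact mul_mem (hK _) (pow_mem hx i)
  have hint : IsIntegral R (algebraMap (CoordinateRing K q (m + 1) r) F f) :=
    hf.map_of_comp_eq (ψ.codRestrict R.toSubring hψ) (algebraMap _ F) (by ext <;> rfl)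
  have h2 := (Valuation.Integers.mem_of_integral (v := R.valuation) (O := R)
    ⟨Subtype.val_injective, fun a => R.valuation_le_one a, fun {a} ha =>
      ⟨⟨a, (R.valuation_le_one_iff a).mp ha⟩, rfl⟩⟩ hint)
  exact (R.valuation_le_one_iff _).mp h2

lemma algHom_coordinateRing_bijective : Function.Bijective
    (fun φ : CoordinateRing K q n r →ₐ[K] K =>
      (⟨(φ (xCoord K q n r), φ (yCoord K q n r)), by
        have := congrArg φ (T_yCoord K q n r)
        rw [← aeval_algHom_apply] at this
        rw [← coe_aeval_eq_eval, ← this]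
        exact (map_T φ.toRingHom n _).symm⟩ :
        {z : K × K // T q n z.2 = (fPoly K q n r).eval z.1})) := by
  constructor
  · intro φ ψ h
    simp only [Subtype.mk.injEq, Prod.mk.injEq] at h
    refine AlgHom.ext_of_adjoin_eq_top (adjoin_coord K q n r) ?_
    rintro z (rfl | rfl)
    · exact h.1
    · exact h.2
  · rintro ⟨⟨a, b⟩, h⟩
    have h' : T q n b = (fPoly K q n r).eval a := h
    have h1 : eval₂ ((aeval a : K[X] →ₐ[K] K) : K[X] →+* K) b (curvePoly K q n r) = 0 := by
      rw [curvePoly, eval₂_sub, eval₂_C, ← coe_eval₂RingHom, map_T]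
      simp [h']
    refine ⟨AdjoinRoot.liftAlgHom _ (aeval a) b h1, ?_⟩
    apply Subtype.ext
    refine Prod.ext ?_ ?_
    · exact (AdjoinRoot.lift_of h1).trans (aeval_X a)
    · exact AdjoinRoot.lift_root h1

end CoordinateRing

/-! ### Counting affine points with the trace -/

section PointCount

variable {K : Type*} [Field K] {q n r : ℕ}

lemma card_le_natDegree_of_isRoot {P : K[X]} (hP : P ≠ 0) (s : Set K) (hs : ∀ z ∈ s, P.IsRoot z) :
    Nat.card s ≤ P.natDegree := by
  classical
  have h : s ⊆ (P.roots.toFinset : Set K) := fun z hz => by simpa [hP] using hs z hz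
  have h1 := Set.ncard_le_ncard h (Finset.finite_toSet _)
  rw [Set.ncard_coe_finset] at h1
  exact h1.trans ((Multiset.toFinset_card_le _).trans (card_roots' _))

/-- The kernel of the trace of a field with `q ^ n` elements has `q ^ (n - 1)` elements. -/
lemma card_T_eq_zero (hadd : PowAdditive K q) (hq : 2 ≤ q) {m : ℕ}
    (hK : Nat.card K = q ^ (m + 1)) : Nat.card {z : K // T q (m + 1) z = 0} = q ^ m := by
  classical
  have hcard_pos : 0 < Nat.card K := by rw [hK]; positivity
  have : Finite K := Nat.finite_of_card_ne_zero hcard_pos.ne'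
  have := Fintype.ofFinite K
  have hfrob : ∀ z : K, z ^ q ^ (m + 1) = z := by
    intro z
    rw [← hK, Nat.card_eq_fintype_card]; exact FiniteField.pow_card z
  let φ : K →+ K := AddMonoidHom.mk' (T q (m + 1)) fun a b => by
    simp [T, hadd.add_pow, Finset.sum_add_distrib]
  -- The Frobenius z ↦ z^q permutes the summands cyclically, so the image consists of roots of X^q −
  -- X. With the degree bound on the kernel, both bounds must be attained.
  have hrange : ∀ z : K, (T q (m + 1) z) ^ q = T q (m + 1) z := by
    intro z
    have h1 : T q (m + 1) z ^ q = ∑ i ∈ Finset.range (m + 1), z ^ q ^ (i + 1) := by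
      have := hadd.sum_pow 1 (Finset.range (m + 1)) fun i => z ^ q ^ i
      simpa [T, ← pow_mul, ← pow_succ] using this
    rw [h1, T, Finset.sum_range_succ, Finset.sum_range_succ', hfrob z, pow_zero, pow_one]
  have hker : Nat.card φ.ker ≤ q ^ m := by
    have hmonic : (T q (m + 1) (X : K[X])).natDegree = q ^ m ∧ T q (m + 1) (X : K[X]) ≠ 0 := by
      have hlt : (T q m (X : K[X])).degree < (X ^ q ^ m : K[X]).degree := by
        rw [degree_X_pow, ← mem_degreeLT]
        refine Submodule.sum_mem _ fun i hi => ?_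
        rw [mem_degreeLT, degree_X_pow]
        exact_mod_cast Nat.pow_lt_pow_right hq (Finset.mem_range.mp hi)
      rw [T_succ]
      refine ⟨by rw [natDegree_add_eq_right_of_degree_lt hlt, natDegree_X_pow], fun h0 => ?_⟩
      have := degree_add_eq_right_of_degree_lt hlt
      rw [h0, degree_zero, degree_X_pow] at this
      exact absurd this (WithBot.bot_ne_coe)
    rw [← hmonic.1]
    refine card_le_natDegree_of_isRoot hmonic.2 (φ.ker : Set K) fun z hz => ?_
    have hz : T q (m + 1) z = 0 := hz
    rw [IsRoot, ← coe_evalRingHom, map_T]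
    simpa using hz
  have hran : Nat.card φ.range ≤ q := by
    obtain ⟨h1, h2⟩ := degree_X_pow_modulus K hq (n := 1) le_rfl
    have h3 := card_le_natDegree_of_isRoot h1.ne_zero (φ.range : Set K) (by
      rintro _ ⟨z, rfl⟩
      have hz : φ z ^ q = φ z := hrange z
      simp [hz])
    rwa [natDegree_eq_of_degree_eq_some h2, pow_one] at h3
  have hprod : Nat.card φ.ker * Nat.card φ.range = q ^ (m + 1) := by
    rw [← hK, AddSubgroup.card_eq_card_quotient_mul_card_addSubgroup φ.ker, mul_comm,
      Nat.card_congr (QuotientAddGroup.quotientKerEquivRange φ).toEquiv]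
  have heq : Nat.card φ.ker = q ^ m := by
    refine le_antisymm hker ?_
    have h1 : q ^ m * q ≤ Nat.card φ.ker * q := by
      rw [← pow_succ, ← hprod]; exact Nat.mul_le_mul_left _ hran
    exact Nat.le_of_mul_le_mul_right h1 (by omega)
  exact heq

/-- The affine curve has `q ^ (n - 1) * q ^ n` rational points. -/
lemma card_affine_points (hadd : PowAdditive K q) (hq : 2 ≤ q) {m : ℕ}
    (hK : Nat.card K = q ^ (m + 1)) (r : ℕ) :
    Nat.card {z : K × K // T q (m + 1) z.2 = (fPoly K q (m + 1) r).eval z.1} =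
      q ^ m * q ^ (m + 1) := by
  have hcard_pos : 0 < Nat.card K := by rw [hK]; positivity
  have : Finite K := Nat.finite_of_card_ne_zero hcard_pos.ne'
  have := Fintype.ofFinite K
  have hfrob : ∀ z : K, z ^ q ^ (m + 1) = z := by
    intro z
    rw [← hK, Nat.card_eq_fintype_card]; exact FiniteField.pow_card z
  -- On K-points f_r(x) equals T_n(x^(1+q^r)), so the shift y ↦ y − x^(1+q^r) makes the equation
  -- independent of x.
  let E : {z : K × K // T q (m + 1) z.2 = (fPoly K q (m + 1) r).eval z.1} ≃
      {z : K // T q (m + 1) z = 0} × K :=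
    { toFun := fun z => (⟨z.1.2 - z.1.1 ^ (1 + q ^ r), by
        rw [T_sub hadd, z.2, eval_fPoly K (hfrob _), sub_self]⟩, z.1.1)
      invFun := fun w => ⟨(w.2, w.1.1 + w.2 ^ (1 + q ^ r)), by
        have h1 := T_sub hadd (m + 1) (w.1.1 + w.2 ^ (1 + q ^ r)) (w.2 ^ (1 + q ^ r))
        rw [add_sub_cancel_right, w.1.2] at h1
        rw [eval_fPoly K (hfrob _)]
        exact (sub_eq_zero.mp h1.symm)⟩
      left_inv := fun z => by simp
      right_inv := fun w => by simp }
  rw [Nat.card_congr E, Nat.card_prod, card_T_eq_zero hadd hq hK, hK]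

end PointCount

end CastleCurve

/-! ### Symmetry of the semigroup of weights -/

namespace CastleCurve

/-- The involution N ↦ l − N exchanges gaps and non-gaps in [0, l], so exactly half of these l + 1
integers are gaps. -/
lemma isSymmetric_of_reflection {S : Set ℕ} {l : ℕ} (h0 : 0 ∈ S)
    (hle : ∀ N ≤ l, N ∈ S ↔ l - N ∉ S) (hlt : ∀ N, l < N → N ∈ S) : IsSymmetric S := by
  classical
  refine ⟨l, ⟨?_, ?_⟩, ?_⟩
  · simpa using (hle 0 (Nat.zero_le l)).mp h0
  · intro N hN
    by_contra! hNl
    exact hN (hlt N hNl)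
  · have hgaps : Sᶜ = ((Finset.range (l + 1)).filter (· ∉ S) : Finset ℕ) := by
      ext N
      simp only [Set.mem_compl_iff, Finset.coe_filter, Finset.mem_range, Set.mem_ofPred_eq]
      refine ⟨fun hN => ⟨?_, hN⟩, fun hN => hN.2⟩
      by_contra! hNl
      exact hN (hlt N (by omega))
    rw [hgaps, Set.ncard_coe_finset]
    have h1 := Finset.card_filter_add_card_filter_not (s := Finset.range (l + 1)) (· ∈ S)
    have h2 : ((Finset.range (l + 1)).filter (· ∈ S)).card =
        ((Finset.range (l + 1)).filter (· ∉ S)).card := by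
      refine Finset.card_bij' (fun N _ => l - N) (fun N _ => l - N) ?_ ?_ ?_ ?_
      · intro N hN
        simp only [Finset.mem_filter, Finset.mem_range] at hN ⊢
        exact ⟨by omega, (hle N (by omega)).mp hN.2⟩
      · intro N hN
        simp only [Finset.mem_filter, Finset.mem_range] at hN ⊢
        refine ⟨by omega, (hle _ (by omega)).mpr ?_⟩
        rw [Nat.sub_sub_self (by omega)]
        exact hN.2
      · intro N hN
        simp only [Finset.mem_filter, Finset.mem_range] at hN
        omega
      · intro N hN
        simp only [Finset.mem_filter, Finset.mem_range] at hN
        omega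
    rw [Finset.card_range] at h1
    omega

/-- A semigroup in which every element has a unique reduced representation is symmetric. -/
theorem isSymmetric_range_weight {ι : Type*} [Fintype ι] {e : ℕ} {a p : ι → ℕ} (he : 0 < e)
    (hinj : ∀ c c' : ι → ℕ, (∀ i, c i < p i) → (∀ i, c' i < p i) →
      ∑ i, c i * a i ≡ ∑ i, c' i * a i [MOD e] → c = c')
    (hprod : ∏ i, p i = e)
    (hred : ∀ m, ∃ m', Reduced p m' ∧ weight e a m' = weight e a m)
    (hone : 1 ∉ Set.range (weight e a)) : IsSymmetric (Set.range (weight e a)) := by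
  classical
  have : NeZero e := ⟨he.ne'⟩
  set S := Set.range (weight e a) with hS
  -- There are e reduced tuples with distinct residues, so they represent every residue modulo e.
  have hsurj : ∀ N : ℤ, ∃ (c : ι → ℕ) (z : ℤ), (∀ i, c i < p i) ∧
      N = z * e + ∑ i, (c i : ℤ) * a i := by
    intro N
    let f : (∀ i, Fin (p i)) → ZMod e := fun c => ((∑ i, (c i : ℕ) * a i : ℕ) : ZMod e)
    have hf : Function.Bijective f := by
      rw [Fintype.bijective_iff_injective_and_card]
      refine ⟨fun c c' hcc => ?_, by simp [Fintype.card_pi, hprod, ZMod.card]⟩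
      have h1 := hinj (fun i => c i) (fun i => c' i) (fun i => (c i).2) (fun i => (c' i).2)
        ((ZMod.natCast_eq_natCast_iff _ _ _).mp hcc)
      exact funext fun i => Fin.ext (congrFun h1 i)
    obtain ⟨c, hc⟩ := hf.2 (N : ZMod e)
    have h1 : (((∑ i, (c i : ℕ) * a i : ℕ) : ℤ) : ZMod e) = (N : ZMod e) := by
      rw [← hc]; simp [f]
    rw [ZMod.intCast_eq_intCast_iff_dvd_sub] at h1
    obtain ⟨z, hz⟩ := h1
    refine ⟨fun i => c i, z, fun i => (c i).2, ?_⟩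
    push_cast at hz
    linarith
  have hmem : ∀ (c : ι → ℕ) (z N : ℤ), (∀ i, c i < p i) → N = z * e + ∑ i, (c i : ℤ) * a i →
      ((∃ n ∈ S, N = (n : ℤ)) ↔ 0 ≤ z) := by
    intro c z N hc hN
    constructor
    · rintro ⟨_, ⟨m, rfl⟩, hm⟩
      obtain ⟨m', hm', hw⟩ := hred m
      have h1 : (z : ℤ) * e + ∑ i, (c i : ℤ) * a i = (m'.1 : ℤ) * e + ∑ i, (m'.2 i : ℤ) * a i := by
        rw [← hN, hm, ← hw, weight]; push_cast; rfl
      have h2 : c = m'.2 := by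
        refine hinj c m'.2 hc hm' ?_
        rw [← Int.natCast_modEq_iff, Int.modEq_iff_dvd]
        refine ⟨z - m'.1, ?_⟩
        push_cast
        linarith
      rw [h2] at h1
      have h3 : z = m'.1 := by
        have : z * (e : ℤ) = m'.1 * e := by linarith
        exact mul_right_cancel₀ (by exact_mod_cast he.ne') this
      omega
    · intro hz
      lift z to ℕ using hz
      refine ⟨weight e a (z, c), ⟨_, rfl⟩, ?_⟩
      rw [hN, weight]; push_cast; rfl
  -- The map N ↦ L − N replaces c_i by p_i − 1 − c_i and z by −1 − z, so it exchanges z ≥ 0 and z <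
  -- 0.
  set L : ℤ := ∑ i, ((p i : ℤ) - 1) * a i - e with hL
  have hrefl : ∀ N : ℤ, (∃ n ∈ S, N = (n : ℤ)) ↔ ¬ ∃ n ∈ S, L - N = (n : ℤ) := by
    intro N
    obtain ⟨c, z, hc, hN⟩ := hsurj N
    rw [hmem c z N hc hN, hmem (fun i => p i - 1 - c i) (-1 - z) (L - N)
      (fun i => by have := hc i; omega)]
    · omega
    · rw [hN, hL]
      have h1 : ∑ i, ((p i - 1 - c i : ℕ) : ℤ) * a i =
          ∑ i, ((p i : ℤ) - 1) * a i - ∑ i, (c i : ℤ) * a i := by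
        rw [← Finset.sum_sub_distrib]
        refine Finset.sum_congr rfl fun i _ => ?_
        have := hc i
        rw [Nat.cast_sub (by omega), Nat.cast_sub (by omega)]
        push_cast
        ring
      rw [h1]
      ring
  have hcast : ∀ n : ℕ, (∃ n' ∈ S, (n : ℤ) = (n' : ℤ)) ↔ n ∈ S := by
    intro n
    constructor
    · rintro ⟨n', hn', h⟩
      rwa [Nat.cast_injective h]
    · exact fun h => ⟨n, h, rfl⟩
  -- Since 1 is a gap, its reflection L − 1 is a weight. This excludes the semigroup ℕ, for which L
  -- = −1.
  have hLpos : 1 ≤ L := by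
    have h1 : ¬ ∃ n ∈ S, ((1 : ℕ) : ℤ) = (n : ℤ) := by rwa [hcast]
    rw [hrefl, not_not] at h1
    obtain ⟨n, -, hn⟩ := h1
    push_cast at hn
    omega
  obtain ⟨l, hl⟩ := Int.eq_ofNat_of_zero_le (by omega : 0 ≤ L)
  refine isSymmetric_of_reflection (l := l) ⟨0, weight_zero⟩ ?_ ?_
  · intro N hN
    rw [← hcast, hrefl, hl, ← Nat.cast_sub hN, hcast]
  · intro N hN
    rw [← hcast, hrefl, hl]
    rintro ⟨n, -, hn⟩
    omega

lemma IsSymmetric.exists_consecutive {S : Set ℕ} (h : IsSymmetric S) : ∃ N ∈ S, N + 1 ∈ S := by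
  obtain ⟨l, ⟨-, hl⟩, -⟩ := h
  have hmem : ∀ N, l < N → N ∈ S := by
    intro N hN
    by_contra hNS
    exact absurd (hl hNS) (not_le.mpr hN)
  exact ⟨l + 1, hmem _ (by omega), hmem _ (by omega)⟩

end CastleCurve

/-! ### The rewriting systems of the curves -/

namespace CastleCurve

section General

lemma eq_of_dvd_sub {a b k : ℕ} (ha : a < k) (hb : b < k) (h : (k : ℤ) ∣ (a : ℤ) - b) : a = b := by
  have h1 : (a : ℤ) - b = 0 := by
    refine Int.eq_zero_of_abs_lt_dvd h ?_
    rw [abs_lt]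
    constructor <;> omega
  omega

/-- The weights of `y, t, u, w` have a unique representation modulo the weight of `x`. -/
lemma residue_injective_general {q Q D E : ℕ} (hq : 0 < q) (hQ : 0 < Q) (hD : 0 < D)
    (c c' : Fin 4 → ℕ) (hc : ∀ i, c i < ![q * Q, D, q, Q] i)
    (hc' : ∀ i, c' i < ![q * Q, D, q, Q] i)
    (h : ∑ i, c i * ![q ^ 2 * Q ^ 2 * D + q * Q * D, q ^ 3 * Q ^ 2 * D + q * Q,
        q ^ 3 * Q ^ 2 * D ^ 2 + Q, q ^ 3 * Q ^ 2 * D * E + q ^ 2 * Q * D + 1] i ≡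
      ∑ i, c' i * ![q ^ 2 * Q ^ 2 * D + q * Q * D, q ^ 3 * Q ^ 2 * D + q * Q,
        q ^ 3 * Q ^ 2 * D ^ 2 + Q, q ^ 3 * Q ^ 2 * D * E + q ^ 2 * Q * D + 1] i
      [MOD q ^ 2 * Q ^ 2 * D]) : c = c' := by
  have hq' : (q : ℤ) ≠ 0 := by exact_mod_cast hq.ne'
  have hQ' : (Q : ℤ) ≠ 0 := by exact_mod_cast hQ.ne'
  have hD' : (D : ℤ) ≠ 0 := by exact_mod_cast hD.ne'
  rw [← Int.natCast_modEq_iff, Int.modEq_iff_dvd] at h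
  obtain ⟨k, hk⟩ := h
  simp only [Fin.sum_univ_four, Matrix.cons_val] at hk
  push_cast at hk
  have hc0 := hc 0
  have hc1 := hc 1
  have hc2 := hc 2
  have hc3 := hc 3
  have hc0' := hc' 0
  have hc1' := hc' 1
  have hc2' := hc' 2
  have hc3' := hc' 3
  simp only [Matrix.cons_val] at hc0 hc1 hc2 hc3 hc0' hc1' hc2' hc3'
  -- The weights are telescopic. All of them and e are divisible by Q except that of w, which is 1
  -- modulo Q; this fixes the exponent of w. Dividing successively by Q, qQ and qQD isolates those
  -- of u, t and y in the same way, modulo q, D and qQ.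
  have e3 : c' 3 = c 3 := by
    refine eq_of_dvd_sub hc3' hc3 ⟨q ^ 2 * Q * D * k
      - ((c' 0 : ℤ) - c 0) * (q ^ 2 * Q * D + q * D) - ((c' 1 : ℤ) - c 1) * (q ^ 3 * Q * D + q)
      - ((c' 2 : ℤ) - c 2) * (q ^ 3 * Q * D ^ 2 + 1)
      - ((c' 3 : ℤ) - c 3) * (q ^ 3 * Q * D * E + q ^ 2 * D), ?_⟩
    linear_combination hk
  rw [e3] at hk
  have e2 : c' 2 = c 2 := by
    refine eq_of_dvd_sub hc2' hc2 ⟨q * Q * D * k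
      - ((c' 0 : ℤ) - c 0) * (q * Q * D + D) - ((c' 1 : ℤ) - c 1) * (q ^ 2 * Q * D + 1)
      - ((c' 2 : ℤ) - c 2) * (q ^ 2 * Q * D ^ 2), ?_⟩
    refine mul_left_cancel₀ hQ' ?_
    linear_combination hk
  rw [e2] at hk
  have e1 : c' 1 = c 1 := by
    refine eq_of_dvd_sub hc1' hc1 ⟨q * Q * k
      - ((c' 0 : ℤ) - c 0) * (q * Q + 1) - ((c' 1 : ℤ) - c 1) * (q ^ 2 * Q), ?_⟩
    refine mul_left_cancel₀ (mul_ne_zero hq' hQ') ?_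
    linear_combination hk
  rw [e1] at hk
  have e0 : c' 0 = c 0 := by
    refine eq_of_dvd_sub hc0' hc0 ⟨k - ((c' 0 : ℤ) - c 0), ?_⟩
    refine mul_left_cancel₀ (mul_ne_zero (mul_ne_zero hq' hQ') hD') ?_
    push_cast
    linear_combination hk
  ext i
  fin_cases i
  · exact e0.symm
  · exact e1.symm
  · exact e2.symm
  · exact e3.symm

variable {K A : Type*} [Field K] [CommRing A] [Algebra K A]

lemma T_mem_weightLT {ι : Type*} [Fintype ι] [DecidableEq ι] {x : A} {g : ι → A} {e : ℕ}
    {a : ι → ℕ} {q N : ℕ} (m : ℕ) (i : ι) (h : ∀ j < m, q ^ j * a i < N) :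
    T q m (g i) ∈ weightLT K x g e a N := by
  refine Submodule.sum_mem _ fun j hj => ?_
  rw [← monomialAt_single (x := x)]
  refine monomialAt_mem_weightLT ?_
  rw [weight_single]
  exact h j (Finset.mem_range.mp hj)

lemma pow_mul_pow_mem_weightLT {ι : Type*} [Fintype ι] [DecidableEq ι] {x : A} {g : ι → A} {e : ℕ}
    {a : ι → ℕ} {N : ℕ} (m k : ℕ) (i : ι) (h : m * e + k * a i < N) :
    x ^ m * g i ^ k ∈ weightLT K x g e a N := by
  have h1 : x ^ m * g i ^ k = monomialAt x g ((m, 0) + (0, Pi.single i k)) := by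
    rw [monomialAt_add, monomialAt_single]
    simp [monomialAt]
  rw [h1]
  refine monomialAt_mem_weightLT ?_
  rw [weight_add, weight_single]
  simpa [weight] using h

set_option maxHeartbeats 1600000 in
/-- The rewriting system of the curve for `n ≥ 3`. -/
theorem rewriteSystem_general {q σ d E Q D : ℕ} (hq : 2 ≤ q) (hQ : Q = q ^ σ) (hD : D = q ^ d)
    (hE : E + 1 = q * D) {x y t u w : A} (hadj : Algebra.adjoin K {x, y} = ⊤)
    (h1 : y ^ q ^ (σ + 1) = x ^ (1 + q ^ (σ + 1)) + T q (σ + 1) t)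
    (h2 : t ^ q ^ d = x ^ E * y - (T q d t + u))
    (h3 : u ^ q = x ^ (q * E) * t + (x ^ ((q - 1) * E) * u + w))
    (h4 : w ^ q ^ σ = - (x ^ ((q ^ (σ + 1) - 1) * E) * u) + (y + T q (σ + 1) t
        - ∑ j ∈ Finset.range σ, x ^ ((q ^ (σ + 1) - q ^ (j + 1)) * E) * w ^ q ^ j)) :
    RewriteSystem K x ![y, t, u, w] (q ^ 2 * Q ^ 2 * D)
      ![q ^ 2 * Q ^ 2 * D + q * Q * D, q ^ 3 * Q ^ 2 * D + q * Q,
        q ^ 3 * Q ^ 2 * D ^ 2 + Q, q ^ 3 * Q ^ 2 * D * E + q ^ 2 * Q * D + 1]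
      ![q * Q, D, q, Q] ![1, 2, 3, 4] := by
  have hQ0 : 0 < Q := by rw [hQ]; positivity
  have hD0 : 0 < D := by rw [hD]; positivity
  have hqQ : q ^ (σ + 1) = q * Q := by rw [hQ, pow_succ']
  rw [hqQ] at h1 h4
  rw [← hD] at h2
  rw [← hQ] at h4
  have hpowQ : ∀ j < σ + 1, q ^ j ≤ Q := fun j hj => by
    rw [hQ]; exact Nat.pow_le_pow_right (by omega) (by omega)
  set e := q ^ 2 * Q ^ 2 * D with he
  set g : Fin 4 → A := ![y, t, u, w] with hg
  set a : Fin 4 → ℕ := ![q ^ 2 * Q ^ 2 * D + q * Q * D, q ^ 3 * Q ^ 2 * D + q * Q,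
        q ^ 3 * Q ^ 2 * D ^ 2 + Q, q ^ 3 * Q ^ 2 * D * E + q ^ 2 * Q * D + 1] with ha
  -- Balancing leading terms forces these values: qQ·a₀ = (1 + qQ)e, D·a₁ = E e + a₀, q·a₂ = qE e +
  -- a₁ and Q·a₃ = (qQ − 1)E e + a₂. The ranks 1, 2, 3, 4 decrease because each rule ends in the
  -- preceding generator.
  have ha0 : a 0 = q ^ 2 * Q ^ 2 * D + q * Q * D := rfl
  have ha1 : a 1 = q ^ 3 * Q ^ 2 * D + q * Q := rfl
  have ha2 : a 2 = q ^ 3 * Q ^ 2 * D ^ 2 + Q := rfl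
  have ha3 : a 3 = q ^ 3 * Q ^ 2 * D * E + q ^ 2 * Q * D + 1 := rfl
  have hmono : ∀ (m k : ℕ) (i : Fin 4),
      monomialAt x g ((m, 0) + (0, Pi.single i k)) = x ^ m * g i ^ k := by
    intro m k i
    rw [monomialAt_add, monomialAt_single]
    simp [monomialAt]
  have hweight : ∀ (m k : ℕ) (i : Fin 4),
      weight e a ((m, 0) + (0, Pi.single i k)) = m * e + k * a i := by
    intro m k i
    rw [weight_add, weight_single]
    simp [weight]
  have hTt : ∀ N, Q * a 1 < N → T q (σ + 1) t ∈ weightLT K x g e a N := fun N hN =>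
    T_mem_weightLT (g := g) (σ + 1) 1 fun j hj =>
      (Nat.mul_le_mul_right _ (hpowQ j hj)).trans_lt hN
  refine ⟨?_, ?_, residue_injective_general (by omega) hQ0 hD0, ?_⟩
  · rw [eq_top_iff, ← hadj]
    refine Algebra.adjoin_mono ?_
    rintro z (rfl | rfl)
    · exact Set.mem_insert _ _
    · exact Set.mem_insert_of_mem _ ⟨0, rfl⟩
  · intro i
    fin_cases i
    · refine ⟨1, one_ne_zero, (1 + q * Q, 0), ?_, ?_, ?_⟩
      · change weight e a (1 + q * Q, 0) = q * Q * a 0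
        rw [ha0]
        simp only [weight, he, Pi.zero_apply, zero_mul, Finset.sum_const_zero, add_zero]
        ring
      · simp
        exact ⟨by omega, hQ0⟩
      · change y ^ (q * Q) - (1 : K) • monomialAt x g (1 + q * Q, 0) ∈
          weightLT K x g e a (q * Q * a 0)
        have : y ^ (q * Q) - (1 : K) • monomialAt x g (1 + q * Q, 0) = T q (σ + 1) t := by
          rw [h1]; simp [monomialAt]
        rw [this]
        refine hTt _ ?_
        rw [ha0, ha1]
        have : q * Q ^ 2 * 1 < q * Q ^ 2 * (q * D) := by
          refine Nat.mul_lt_mul_of_pos_left ?_ (by positivity)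
          nlinarith
        nlinarith
    · refine ⟨1, one_ne_zero, (E, 0) + (0, Pi.single 0 1), ?_, ?_, ?_⟩
      · change _ = D * a 1
        rw [hweight, ha0, ha1, he]
        have : E * (q ^ 2 * Q ^ 2 * D) + q ^ 2 * Q ^ 2 * D = (E + 1) * (q ^ 2 * Q ^ 2 * D) := by ring
        rw [one_mul, ← add_assoc, this, hE]
        ring
      · simp [Fin.sum_univ_four]
        omega
      · change t ^ D - (1 : K) • monomialAt x g ((E, 0) + (0, Pi.single 0 1)) ∈
          weightLT K x g e a (D * a 1)
        have : t ^ D - (1 : K) • monomialAt x g ((E, 0) + (0, Pi.single 0 1)) =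
            -(T q d t + x ^ 0 * u ^ 1) := by
          rw [h2, hmono]; simp [hg]
        rw [this]
        refine neg_mem (add_mem ?_ ?_)
        · refine T_mem_weightLT (g := g) d 1 fun j hj => ?_
          refine Nat.mul_lt_mul_of_pos_right ?_ (by rw [ha1]; positivity)
          rw [hD]
          exact Nat.pow_lt_pow_right hq hj
        · refine pow_mul_pow_mem_weightLT (g := g) 0 1 2 ?_
          rw [ha1, ha2]
          have : Q * 1 < Q * (q * D) := by
            refine Nat.mul_lt_mul_of_pos_left ?_ hQ0
            nlinarith
          nlinarith
    · refine ⟨1, one_ne_zero, (q * E, 0) + (0, Pi.single 1 1), ?_, ?_, ?_⟩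
      · change _ = q * a 2
        rw [hweight, ha1, ha2, he]
        have : q * E * (q ^ 2 * Q ^ 2 * D) + 1 * (q ^ 3 * Q ^ 2 * D + q * Q) =
          q * (E + 1) * (q ^ 2 * Q ^ 2 * D) + q * Q := by ring
        rw [this, hE]
        ring
      · simp [Fin.sum_univ_four]
        omega
      · change u ^ q - (1 : K) • monomialAt x g ((q * E, 0) + (0, Pi.single 1 1)) ∈
          weightLT K x g e a (q * a 2)
        have : u ^ q - (1 : K) • monomialAt x g ((q * E, 0) + (0, Pi.single 1 1)) =
            x ^ ((q - 1) * E) * u ^ 1 + x ^ 0 * w ^ 1 := by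
          rw [h3, hmono]; simp [hg]
        rw [this]
        obtain ⟨b, rfl⟩ : ∃ b, q = b + 1 := ⟨q - 1, by omega⟩
        have hb : 0 < b := by omega
        refine add_mem (pow_mul_pow_mem_weightLT (g := g) _ 1 2 ?_)
          (pow_mul_pow_mem_weightLT (g := g) 0 1 3 ?_)
        · have h5 : E * e < a 2 := by
            rw [ha2, he]
            have : E * ((b + 1) ^ 2 * Q ^ 2 * D) ≤ (E + 1) * ((b + 1) ^ 2 * Q ^ 2 * D) :=
              Nat.mul_le_mul_right _ (by omega)
            rw [hE] at this
            have h6 : (b + 1) * D * ((b + 1) ^ 2 * Q ^ 2 * D) = (b + 1) ^ 3 * Q ^ 2 * D ^ 2 := by ring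
            omega
          have h6 : b * (E * e) < b * a 2 := Nat.mul_lt_mul_of_pos_left h5 hb
          simp only [Nat.add_sub_cancel]
          calc b * E * e + 1 * a 2 = b * (E * e) + a 2 := by ring
            _ < b * a 2 + a 2 := by omega
            _ = (b + 1) * a 2 := by ring
        -- With q = b + 1, this identity gives a₃ < q a₂, since q²QD ≤ q e and 1 < qQ.
        · have h5 : a 3 + (b + 1) * e + (b + 1) * Q =
              (b + 1) * a 2 + (b + 1) ^ 2 * Q * D + 1 := by
            rw [ha2, ha3, he]
            have h6 : (b + 1) ^ 3 * Q ^ 2 * D * E + (b + 1) * ((b + 1) ^ 2 * Q ^ 2 * D) =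
              (b + 1) ^ 3 * Q ^ 2 * D * (E + 1) := by ring
            rw [hE] at h6
            have h7 : (b + 1) ^ 3 * Q ^ 2 * D * ((b + 1) * D) =
              (b + 1) * ((b + 1) ^ 3 * Q ^ 2 * D ^ 2) := by ring
            linarith
          have h6 : (b + 1) ^ 2 * Q * D ≤ (b + 1) * e := by
            rw [he]
            calc (b + 1) ^ 2 * Q * D = ((b + 1) ^ 2 * Q * D) * 1 := by ring
              _ ≤ ((b + 1) ^ 2 * Q * D) * ((b + 1) * Q) :=
                Nat.mul_le_mul_left _ (Nat.mul_pos (by omega) hQ0)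
              _ = _ := by ring
          have h7 : 1 < (b + 1) * Q := by nlinarith
          omega
    · refine ⟨-1, by simp, ((q * Q - 1) * E, 0) + (0, Pi.single 2 1), ?_, ?_, ?_⟩
      · change _ = Q * a 3
        rw [hweight, ha2, ha3]
        obtain ⟨b, hb⟩ : ∃ b, q * Q = b + 1 :=
          ⟨q * Q - 1, by have : 0 < q * Q := by positivity
                         omega⟩
        rw [hb, Nat.add_sub_cancel]
        have h5 : b * E * e + E * e = q * Q * E * e := by rw [hb]; ring
        have h6 : E * e + e = q ^ 3 * Q ^ 2 * D ^ 2 := by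
          have : E * e + e = (E + 1) * e := by ring
          rw [this, hE, he]; ring
        have h7 : Q * (q ^ 3 * Q ^ 2 * D * E + q ^ 2 * Q * D + 1) = q * Q * E * e + e + Q := by
          rw [he]; ring
        rw [h7]
        omega
      · simp [Fin.sum_univ_four]
        omega
      · change w ^ Q - (-1 : K) • monomialAt x g (((q * Q - 1) * E, 0) + (0, Pi.single 2 1)) ∈
          weightLT K x g e a (Q * a 3)
        have : w ^ Q - (-1 : K) • monomialAt x g (((q * Q - 1) * E, 0) + (0, Pi.single 2 1)) =
            x ^ 0 * y ^ 1 + T q (σ + 1) t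
            - ∑ j ∈ Finset.range σ, x ^ ((q * Q - q ^ (j + 1)) * E) * w ^ q ^ j := by
          rw [h4, hmono]; simp [hg]
        rw [this]
        have hE1 : 1 ≤ E := by
          have : 2 ≤ q * D := by nlinarith
          omega
        have ha3' : q ^ 3 * Q ^ 2 * D + q ^ 2 * Q * D + 1 ≤ a 3 := by
          rw [ha3]
          have := Nat.mul_le_mul_left (q ^ 3 * Q ^ 2 * D) hE1
          omega
        refine sub_mem (add_mem (pow_mul_pow_mem_weightLT (g := g) 0 1 0 ?_) (hTt _ ?_))
          (Submodule.sum_mem _ fun j hj => ?_)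
        · have h5 : a 0 < a 3 := by
            refine lt_of_lt_of_le ?_ ha3'
            rw [ha0]
            have h6 : q ^ 2 * Q ^ 2 * D ≤ q ^ 3 * Q ^ 2 * D := by
              have : q ^ 2 ≤ q ^ 3 := Nat.pow_le_pow_right (by omega) (by omega)
              gcongr
            have h7 : q * Q * D ≤ q ^ 2 * Q * D := by
              have : q ≤ q ^ 2 := Nat.le_self_pow (by omega) q
              gcongr
            omega
          have h6 : 1 * a 3 ≤ Q * a 3 := Nat.mul_le_mul_right _ hQ0
          omega
        · refine Nat.mul_lt_mul_of_pos_left (lt_of_lt_of_le ?_ ha3') hQ0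
          rw [ha1]
          have h7 : q * Q ≤ q ^ 2 * Q * D := by
            calc q * Q = q * Q * 1 := by ring
              _ ≤ q * Q * (q * D) := Nat.mul_le_mul_left _ (Nat.mul_pos (by omega) hD0)
              _ = _ := by ring
          omega
        · refine pow_mul_pow_mem_weightLT (g := g) _ _ 3 ?_
          have hj := Finset.mem_range.mp hj
          have h5 : q ^ j < Q := by rw [hQ]; exact Nat.pow_lt_pow_right hq hj
          have h6 : q * q ^ j ≤ q * Q := Nat.mul_le_mul_left _ h5.le
          obtain ⟨b, hb⟩ := Nat.exists_eq_add_of_le h6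
          -- The j-th summand has weight qQ·E e + q^j(q²QD + 1), which differs from Q a₃ only in
          -- having q^j < Q as the last coefficient.
          have h7 : a 3 = q * e * E + (q ^ 2 * Q * D + 1) := by rw [ha3, he]; ring
          have h8 : q ^ j * (q ^ 2 * Q * D + 1) < Q * (q ^ 2 * Q * D + 1) :=
            Nat.mul_lt_mul_of_pos_right h5 (by positivity)
          rw [pow_succ', hb, Nat.add_sub_cancel_left, h7]
          calc b * E * e + q ^ j * (q * e * E + (q ^ 2 * Q * D + 1))
              = (q * q ^ j + b) * (E * e) + q ^ j * (q ^ 2 * Q * D + 1) := by ring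
            _ < (q * Q) * (E * e) + Q * (q ^ 2 * Q * D + 1) := by rw [← hb]; omega
            _ = _ := by ring
  · simp only [Fin.prod_univ_four, Matrix.cons_val]
    rw [he]
    ring

/-- The rewriting system of the Hermitian curve, the case `n = 2`. -/
theorem rewriteSystem_hermitian {q : ℕ} (hq : 2 ≤ q) (h2 : (2 : K) ≠ 0) {x y : A}
    (hadj : Algebra.adjoin K {x, y} = ⊤) (h : y ^ q = (2 : K) • x ^ (1 + q) - y) :
    RewriteSystem K x ![y] q ![q + 1] ![q] ![1] := by
  refine ⟨?_, ?_, ?_, by simp⟩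
  · rw [eq_top_iff, ← hadj]
    refine Algebra.adjoin_mono ?_
    rintro z (rfl | rfl)
    · exact Set.mem_insert _ _
    · exact Set.mem_insert_of_mem _ ⟨0, rfl⟩
  · intro i
    obtain rfl := Subsingleton.elim i 0
    -- The leading coefficient is 2, which is where odd characteristic enters.
    refine ⟨2, h2, (1 + q, 0), ?_, by simp; omega, ?_⟩
    · simp [weight]; ring
    · change y ^ q - (2 : K) • monomialAt x ![y] (1 + q, 0) ∈
        weightLT K x ![y] q ![q + 1] (q * (q + 1))
      have : y ^ q - (2 : K) • monomialAt x ![y] (1 + q, 0) = -(x ^ 0 * y ^ 1) := by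
        rw [h]; simp [monomialAt]
      rw [this]
      refine neg_mem (pow_mul_pow_mem_weightLT (g := ![y]) 0 1 0 ?_)
      simp
      nlinarith
  · intro c c' hc hc' hcc
    have hc0 := hc 0
    have hc0' := hc' 0
    simp only [Fin.sum_univ_one, Matrix.cons_val] at hcc hc0 hc0'
    have h1 : c 0 ≡ c' 0 [MOD q] := by
      simpa [Nat.ModEq, mul_add] using hcc
    have h2 := Nat.ModEq.eq_of_lt_of_lt h1 hc0 hc0'
    ext i
    rwa [Subsingleton.elim i 0]

end General

end CastleCurve

/-! ### The weight valuation of the curves -/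

namespace CastleCurve

open WithZero

/-- The coordinate ring of the curve has a weight valuation in which `x` has weight `q ^ (n - 1)`,
the smallest nonzero weight, and the semigroup of weights is symmetric. -/
structure HasWeight (K : Type*) [Field K] (q m r : ℕ) (S : Set ℕ)
    (v : Valuation (CoordinateRing K q (m + 1) r) (WithZero (Multiplicative ℤ))) : Prop where
  isWeightValuation : IsWeightValuation K (xCoord K q (m + 1) r) (q ^ m) S v
  isSymmetric : IsSymmetric S
  isLeast : IsLeast {N | N ∈ S ∧ N ≠ 0} (q ^ m)
  x_lt_y : v (xCoord K q (m + 1) r) < v (yCoord K q (m + 1) r)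

/-- No generator weighs less than x, so q^m is the least nonzero weight. In particular 1 is a gap,
as the symmetry argument requires. -/
lemma RewriteSystem.exists_hasWeight {K : Type*} [Field K] {q m r : ℕ} (hq : 2 ≤ q) (hm : 1 ≤ m)
    {ι : Type*} [Fintype ι] {g : ι → CoordinateRing K q (m + 1) r} {a p rk : ι → ℕ}
    (h : RewriteSystem K (xCoord K q (m + 1) r) g (q ^ m) a p rk) (ha : ∀ i, q ^ m ≤ a i) {i : ι}
    (hy : g i = yCoord K q (m + 1) r) (hi : q ^ m < a i) : ∃ S v, HasWeight K q m r S v := by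
  classical
  have he : 0 < q ^ m := by positivity
  have he1 : 1 < q ^ m := Nat.one_lt_pow (by omega) hq
  have := nontrivial_coordinateRing (K := K) hq m r
  have hli := h.linearIndependent (xCoord_eq K q (m + 1) r) (finrank_coordinateRing hq m r)
  obtain ⟨v, hv, hmon⟩ := h.exists_isWeightValuation he hli
  have hleast : IsLeast {N | N ∈ Set.range (weight (q ^ m) a) ∧ N ≠ 0} (q ^ m) := by
    refine ⟨⟨⟨(1, 0), by simp [weight]⟩, he.ne'⟩, ?_⟩
    rintro _ ⟨⟨⟨k, c⟩, rfl⟩, hne⟩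
    by_contra! hlt
    apply hne
    have hk : k = 0 := by
      by_contra hk
      have : 1 * q ^ m ≤ k * q ^ m := Nat.mul_le_mul_right _ (by omega)
      simp only [weight] at hlt
      omega
    have hc : c = 0 := by
      ext j
      by_contra hj
      have hj : c j ≠ 0 := hj
      have h1 : 1 * a j ≤ c j * a j := Nat.mul_le_mul_right _ (by omega)
      have h2 : c j * a j ≤ ∑ i, c i * a i :=
        Finset.single_le_sum (f := fun i => c i * a i) (fun _ _ => Nat.zero_le _)
          (Finset.mem_univ j)
      have := ha j
      simp only [weight] at hlt
      omega
    simp [weight, hk, hc]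
  refine ⟨_, v, hv, isSymmetric_range_weight he h.residue_injective h.prod_eq ?_ ?_, hleast, ?_⟩
  · intro m
    obtain ⟨-, -, m', h1, h2, -⟩ := h.exists_reduced m
    exact ⟨m', h1, h2⟩
  · intro h1
    have := hleast.2 ⟨h1, one_ne_zero⟩
    omega
  · have hvy : v (yCoord K q (m + 1) r) = exp (a i : ℤ) := by
      have := hmon (0, Pi.single i 1)
      rwa [monomialAt_single, weight_single, pow_one, one_mul, hy] at this
    rw [hv.map_x, hvy, exp_lt_exp]
    exact_mod_cast hi

lemma exists_rewriteSystem_general {K A : Type*} [Field K] [CommRing A] [Algebra K A] {q σ d : ℕ}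
    (hadd : PowAdditive A q) (hq : 2 ≤ q) (hcop : Nat.Coprime (σ + 1 + (d + 1)) (σ + 1)) {x y : A}
    (hadj : Algebra.adjoin K {x, y} = ⊤)
    (hxy : T q (σ + 1 + (σ + 1 + (d + 1))) y = T q (σ + 1) (x ^ (1 + q ^ (σ + 1 + (d + 1))))
      + T q (σ + 1 + (d + 1)) (x ^ (1 + q ^ (σ + 1)))) :
    ∃ (g : Fin 4 → A) (a p rk : Fin 4 → ℕ), RewriteSystem K x g (q ^ (2 * σ + 2 + d)) a p rk ∧
      (∀ i, q ^ (2 * σ + 2 + d) ≤ a i) ∧ g 0 = y ∧ q ^ (2 * σ + 2 + d) < a 0 := by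
  have hE : q ^ (d + 1) - 1 + 1 = q ^ (d + 1) :=
    Nat.sub_add_cancel (Nat.one_le_pow _ _ (by omega))
  obtain ⟨t, u, w, h1, h2, h3, h4⟩ := exists_generators hadd (by omega) hE hcop hxy
  have hsys := rewriteSystem_general (K := K) hq (rfl : q ^ σ = q ^ σ) (rfl : q ^ d = q ^ d)
    (by rw [hE, pow_succ']) hadj h1 h2 h3 h4
  have he : q ^ (2 * σ + 2 + d) = q ^ 2 * (q ^ σ) ^ 2 * q ^ d := by ring
  rw [he]
  refine ⟨_, _, _, _, hsys, ?_, rfl, ?_⟩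
  · have h23 : q ^ 2 * (q ^ σ) ^ 2 * q ^ d ≤ q ^ 3 * (q ^ σ) ^ 2 * q ^ d := by
      have : q ^ 2 ≤ q ^ 3 := Nat.pow_le_pow_right (by omega) (by omega)
      gcongr
    have hE1 : 1 ≤ q ^ (d + 1) - 1 := by
      have : 1 < q ^ (d + 1) := Nat.one_lt_pow (by omega) hq
      omega
    have hD0 : 0 < q ^ d := by positivity
    rw [Fin.forall_fin_succ, Fin.forall_fin_succ, Fin.forall_fin_succ, Fin.forall_fin_succ]
    refine ⟨Nat.le_add_right _ _, h23.trans (Nat.le_add_right _ _), h23.trans ?_, h23.trans ?_,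
      fun i => i.elim0⟩
    · refine le_trans ?_ (Nat.le_add_right _ _)
      have : q ^ d ≤ (q ^ d) ^ 2 := Nat.le_self_pow (by omega) _
      gcongr
    · exact (Nat.le_mul_of_pos_right _ hE1).trans
        ((Nat.le_add_right _ _).trans (Nat.le_add_right _ _))
  · exact Nat.lt_add_of_pos_right (by positivity)

/-- The curves of the family have a weight valuation over every field of characteristic `p`. -/
theorem exists_hasWeight (K : Type*) [Field K] (p : ℕ) [Fact p.Prime] [CharP K p] {q k m r : ℕ}
    (hqp : q = p ^ k) (hq : 2 ≤ q) (hm : 1 ≤ m) (hr : m + 1 ≤ 2 * r) (hrn : r < m + 1)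
    (hcop : Nat.Coprime (m + 1) r) (hodd : m + 1 = 2 → Odd q) :
    ∃ S v, HasWeight K q m r S v := by
  have := nontrivial_coordinateRing (K := K) hq m r
  have hchar : CharP (CoordinateRing K q (m + 1) r) p :=
    charP_of_injective_algebraMap (algebraMap K (CoordinateRing K q (m + 1) r)).injective p
  have hadd : PowAdditive (CoordinateRing K q (m + 1) r) q := by
    have h := PowAdditive.of_charP (A := CoordinateRing K q (m + 1) r) p k
    rwa [← hqp] at h
  have hadj := adjoin_coord K q (m + 1) r
  obtain ⟨s, hs⟩ : ∃ s, m + 1 = s + r := ⟨m + 1 - r, by omega⟩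
  have hs1 : 1 ≤ s := by omega
  have hr1 : 1 ≤ r := by omega
  have hxy : T q (m + 1) (yCoord K q (m + 1) r) =
      T q s (xCoord K q (m + 1) r ^ (1 + q ^ r)) + T q r (xCoord K q (m + 1) r ^ (1 + q ^ s)) := by
    rw [T_yCoord]
    have hf : fPoly K q (m + 1) r = T q s (X ^ (1 + q ^ r)) + T q r (X ^ (1 + q ^ s)) := by
      rw [hs]; exact fPoly_eq K hq hs1 hr1
    rw [hf]
    have hT : ∀ (i : ℕ) (z : K[X]), aeval (xCoord K q (m + 1) r) (T q i z) =
        T q i (aeval (xCoord K q (m + 1) r) z) := fun i z =>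
      map_T (aeval (xCoord K q (m + 1) r)).toRingHom i z
    rw [map_add, hT, hT, map_pow, map_pow, aeval_X]
  have hcop' : Nat.Coprime r s := by
    rw [hs] at hcop
    exact (Nat.coprime_add_self_left.mp hcop).symm
  -- The bound n ≤ 2r means s ≤ r, and s = r together with coprimality leaves only s = r = 1.
  rcases Nat.lt_or_ge s r with hsr | hsr
  · obtain ⟨σ, rfl⟩ : ∃ σ, s = σ + 1 := ⟨s - 1, by omega⟩
    obtain ⟨d, rfl⟩ : ∃ d, r = σ + 1 + (d + 1) := ⟨r - σ - 2, by omega⟩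
    obtain rfl : m = 2 * σ + 2 + d := by omega
    obtain ⟨g, a, p, rk, hsys, ha, hg, ha0⟩ := exists_rewriteSystem_general (K := K) hadd hq hcop'
      hadj (by rw [← hs]; exact hxy)
    exact hsys.exists_hasWeight hq hm ha hg ha0
  · obtain rfl : s = r := by omega
    obtain rfl : s = 1 := by simpa using hcop'
    obtain rfl : m = 1 := by omega
    have hodd := hodd rfl
    have h2 : (2 : K) ≠ 0 := by
      intro h0
      have hp2 : p ∣ 2 := (CharP.cast_eq_zero_iff K p 2).mp (by exact_mod_cast h0)
      have hp : p = 2 := (Nat.prime_dvd_prime_iff_eq Fact.out Nat.prime_two).mp hp2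
      rw [hqp, hp] at hodd
      have hk : k ≠ 0 := by rintro rfl; rw [hqp] at hq; simp at hq
      exact (Nat.not_odd_iff_even.mpr (even_two.pow_of_ne_zero hk)) hodd
    have hsys := rewriteSystem_hermitian (K := K) hq h2 hadj (by
      rw [T_succ, T_one, pow_one, T_one] at hxy
      rw [Algebra.smul_def, map_ofNat]
      linear_combination hxy)
    have hsys' : RewriteSystem K (xCoord K q (1 + 1) 1) ![yCoord K q (1 + 1) 1] (q ^ 1) ![q + 1]
        ![q] ![1] := by
      rw [pow_one]; exact hsys
    refine hsys'.exists_hasWeight hq hm (fun i => ?_) (i := 0) rfl ?_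
    · rw [Subsingleton.elim i 0, pow_one]
      exact Nat.le_succ q
    · rw [pow_one]
      exact Nat.lt_succ_self q

end CastleCurve

/-! ### The point at infinity and the number of rational points -/

namespace CastleCurve

section Castle

variable {K : Type*} [Field K] {q m r : ℕ} {S : Set ℕ}
  {v : Valuation (CoordinateRing K q (m + 1) r) (WithZero (Multiplicative ℤ))}

/-- A place lies over the point at infinity if and only if it is the place of the weight
valuation. -/
lemma HasWeight.liesOverInfinity_iff [IsDomain (CoordinateRing K q (m + 1) r)]
    (h : HasWeight K q m r S v) (hq : 2 ≤ q) (Q : Place K (FunctionField K q (m + 1) r)) :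
    LiesOverInfinity K q (m + 1) r Q ↔
      Q = h.isWeightValuation.place _ h.isSymmetric.exists_consecutive := by
  have he : 0 < q ^ m := by positivity
  have hx : xFun K q (m + 1) r = algebraMap _ _ (xCoord K q (m + 1) r) := rfl
  have hy : yFun K q (m + 1) r = algebraMap _ _ (yCoord K q (m + 1) r) := rfl
  have hvx : 1 < v (xCoord K q (m + 1) r) := by
    rw [h.isWeightValuation.map_x, ← WithZero.exp_zero, WithZero.exp_lt_exp]
    exact_mod_cast he
  have hvy := hvx.trans h.x_lt_y
  have hvy0 : 0 < v (yCoord K q (m + 1) r) := zero_lt_one.trans hvy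
  constructor
  -- Away from the place of the valuation y is regular, so 1/y cannot vanish there.
  · rintro ⟨-, h2⟩
    by_contra hQ
    have h3 := h.isWeightValuation.algebraMap_mem_of_ne he _
      (algebraMap_mem_valuationSubring hq m r) hQ (yCoord K q (m + 1) r)
    rw [← Place.valuation_le_one_iff, ← hy] at h3
    have hy0 : yFun K q (m + 1) r ≠ 0 := by
      rw [hy]
      have : yCoord K q (m + 1) r ≠ 0 := by
        intro h0; rw [h0, map_zero] at hvy0; exact lt_irrefl _ hvy0
      simpa using this
    rw [map_div₀, map_one, one_div,
      inv_lt_one₀ (zero_lt_iff.mpr ((map_ne_zero Q.valuation).mpr hy0))] at h2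
    exact absurd h3 (not_le.mpr h2)
  · rintro rfl
    rw [LiesOverInfinity, hx, hy, map_div₀, map_div₀, map_one,
      IsWeightValuation.place_valuation_algebraMap, IsWeightValuation.place_valuation_algebraMap,
      div_lt_one₀ hvy0, div_lt_one₀ hvy0]
    exact ⟨h.x_lt_y, hvy⟩

lemma HasWeight.card_isRational
    [IsDedekindDomain (CoordinateRing K q (m + 1) r)]
    (h : HasWeight K q m r S v) (hadd : PowAdditive K q) (hq : 2 ≤ q)
    (hK : Nat.card K = q ^ (m + 1)) :
    Nat.card {Q : Place K (FunctionField K q (m + 1) r) // Q.IsRational} =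
      q ^ m * q ^ (m + 1) + 1 := by
  have hcard := card_affine_points hadd hq hK r
  rw [← Nat.card_eq_of_bijective _ (algHom_coordinateRing_bijective (K := K))] at hcard
  have : Finite (CoordinateRing K q (m + 1) r →ₐ[K] K) :=
    Nat.finite_of_card_ne_zero (by rw [hcard]; positivity)
  rw [h.isWeightValuation.card_isRational (by positivity) h.isSymmetric.exists_consecutive
    (algebraMap_mem_valuationSubring hq m r), hcard]

end Castle

end CastleCurve

/-! ### The Castle property -/

theorem mainTheorem3 (K : Type*) [Field K] (q n r : ℕ) (hq : IsPrimePow q)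
    (hK : Nat.card K = q ^ n) (hn : 2 ≤ n) (hr : n ≤ 2 * r) (hrn : r < n)
    (hcop : Nat.Coprime n r) (hodd : n = 2 → Odd q) :
    CastleCurve.IsGeometricallyIrreducible K q n r ∧
    ∃ _ : IsDomain (CastleCurve.CoordinateRing K q n r),
    ∃ Pinf : CastleCurve.Place K (CastleCurve.FunctionField K q n r),
      (∀ Q : CastleCurve.Place K (CastleCurve.FunctionField K q n r),
        CastleCurve.LiesOverInfinity K q n r Q ↔ Q = Pinf) ∧
      CastleCurve.IsCastle Pinf ∧
      IsLeast {m | m ∈ Pinf.weierstrassSemigroup ∧ m ≠ 0} (q ^ (n - 1)) ∧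
      Nat.card {Q : CastleCurve.Place K (CastleCurve.FunctionField K q n r) // Q.IsRational} =
        q ^ (n - 1) * q ^ n + 1 := by
  open CastleCurve in
  obtain ⟨m, rfl⟩ : ∃ m, n = m + 1 := ⟨n - 1, by omega⟩
  have hm : 1 ≤ m := by omega
  have hq2 : 2 ≤ q := hq.two_le
  obtain ⟨p, k, hp, hk, hqp⟩ := hq
  have hp : p.Prime := hp.nat_prime
  have : Fact p.Prime := ⟨hp⟩
  have : Finite K := Nat.finite_of_card_ne_zero (by rw [hK]; positivity)
  have hchar : CharP K p := by
    have := Fintype.ofFinite K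
    obtain ⟨p', hp'⟩ := CharP.exists K
    obtain ⟨j, hpp, hj⟩ := FiniteField.card K p'
    have h1 : p' ∣ p ^ (k * (m + 1)) := by
      rw [pow_mul, hqp, ← hK, Nat.card_eq_fintype_card, hj]
      exact dvd_pow_self _ j.ne_zero
    have h2 := (Nat.prime_dvd_prime_iff_eq hpp hp).mp (hpp.dvd_of_dvd_pow h1)
    rwa [← h2]
  have hadd : PowAdditive K q := hqp ▸ PowAdditive.of_charP p k
  have hq0 : (q : K) = 0 := by
    rw [← hqp, Nat.cast_pow, CharP.cast_eq_zero, zero_pow hk.ne']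
  obtain ⟨S, v, h⟩ := exists_hasWeight K p hqp.symm hq2 hm hr hrn hcop hodd
  refine ⟨?_, ?_⟩
  -- The weight valuation over the algebraic closure makes the coordinate ring there a domain, so
  -- the defining polynomial is prime.
  · have : CharP (AlgebraicClosure K) p :=
      charP_of_injective_algebraMap (algebraMap K (AlgebraicClosure K)).injective p
    obtain ⟨S', v', h'⟩ := exists_hasWeight (AlgebraicClosure K) p hqp.symm hq2 hm hr hrn hcop hodd
    have := nontrivial_coordinateRing (K := AlgebraicClosure K) hq2 m r
    have := h'.isWeightValuation.isDomain
    rw [IsGeometricallyIrreducible, map_curvePoly K _ hq2 r (by omega)]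
    exact irreducible_of_isDomain_adjoinRoot (curvePoly_monic _ hq2 m r).1.ne_zero
  · have := nontrivial_coordinateRing (K := K) hq2 m r
    have hdom := h.isWeightValuation.isDomain
    have := isDedekindDomain_coordinateRing hq2 hq0 m r
    have hsemi := h.isWeightValuation.weierstrassSemigroup_place
      (F := FunctionField K q (m + 1) r) (by positivity) h.isSymmetric.exists_consecutive
      (algebraMap_mem_valuationSubring hq2 m r)
    have hcard := h.card_isRational hadd hq2 hK
    refine ⟨hdom, h.isWeightValuation.place _ h.isSymmetric.exists_consecutive,
      h.liesOverInfinity_iff hq2, ⟨h.isWeightValuation.place_isRational _, ?_, q ^ m, ?_, ?_⟩,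
      ?_, ?_⟩
    · rw [hsemi]; exact h.isSymmetric
    · rw [hsemi]; exact h.isLeast
    · rw [hK]; exact hcard
    · rw [hsemi]; exact h.isLeast
    · exact hcard
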